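/- Let $\mathfrak g$ be a finite-dimensional real Lie algebra with an ad-invariant non-degenerate symmetric bilinear form $\langle\cdot,\cdot\rangle$, let $e_i$ and $e^i$ denote bases of $\mathfrak g$ that are dual with respect to it, and let $\phi=\frac1{12}\sum_{i,j,k}\langle e^i,[e^j,e^k]\rangle\,e_i\wedge e_j\wedge e_k\in\wedge^3\mathfrak g$. Let $M$ be a smooth manifold with an action of $\mathfrak g$, that is, a Lie algebra morphism from $\mathfrak g$ to vector fields. A quasi-Poisson $\mathfrak g$-bialgebroid over $M$ is a triple $(A,\rho,\mathcal D)$ that consists of a Lie algebroid $A\to M$, a morphism of Lie algebroids $\rho:M\times\mathfrak g\to A$ from the action Lie algebroid (over the identity of $M$), and a derivation $\mathcal D$ of degree $+1$ of the Gerstenhaber algebra $(\Gamma(\wedge A),\wedge,[\cdot,\cdot]_A)$, such that $\mathcal D\rho(\xi)=0$ for all $\xi\in\mathfrak g$ (viewed as constant sections of $M\times\mathfrak g$) and $\mathcal D^2=\frac12[\rho(\phi),\cdot]_A$. Here $[\cdot,\cdot]_A$ is the Schouten bracket that extends the bracket of sections of $A$ and $[X,f]_A=\mathbf a_A(X)f$,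 where $\mathbf a_A$ is the anchor of $A$, and $\rho$ is extended to $\wedge\mathfrak g\to\Gamma(\wedge A)$ as a morphism of algebras. **Proposition.** Let $(A,\rho,\mathcal D)$ be a quasi-Poisson $\mathfrak g$-bialgebroid over $M$. Then: 1. The dual bundle $A^*$ carries a Lie algebroid structure whose differential on $\Gamma(\wedge A)$ is, for all dual bases $e_i,e^i$, $$d_{A^*}=\mathcal D+\frac12\sum_i\rho(e^i)\wedge[\rho(e_i),\cdot]_A .$$ That is, $d_{A^*}$ is a derivation of degree $+1$ with square zero, and the anchor $\mathbf a$ and the bracket of $A^*$ satisfy $(d_{A^*}f)(\alpha)=\mathbf a(\alpha)f$ and $(d_{A^*}X)(\alpha,\beta)=\mathbf a(\alpha)\beta(X)-\mathbf a(\beta)\alpha(X)-[\alpha,\beta](X)$ for $f\in C^\infty(M)$, $X\in\Gamma(A)$ and $\alpha,\beta\in\Gamma(A^*)$. 2. The action of $\mathfrak g$ on $A^*$, given by $(\mathcal L_\xi\alpha)(X)=\xi\cdot\alpha(X)-\alpha([\rho(\xi),X])$ for $\xi\in\mathfrak g$, preserves this Lie algebroid structure: each $\mathcal L_\xi$ is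 a derivation of the bracket of $A^*$, and the anchor of $A^*$ is $\mathfrak g$-equivariant. 3. The map $\mu_\rho:A^*\to\mathfrak g$ with $\langle\mu_\rho(\alpha),\xi\rangle=\alpha(\rho(\xi))$ is a morphism of Lie algebroids from this Lie algebroid to $\mathfrak g$, regarded as a Lie algebroid over a point. -/

import Mathlib

open scoped Manifold ContDiff Bundle

set_option linter.unusedSectionVars false

noncomputable section

namespace QuasiPoisson

/-! ## Lie-Rinehart structures and their Gerstenhaber algebra -/

section Algebra

/-- A Lie-Rinehart structure over `ℝ` on a module `L` over a commutative algebra `C`. For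
`C = C^∞(M)` and `L` the module of sections of a vector bundle, this is the structure that a Lie
algebroid induces on sections. -/
structure LieRinehartStr (C L : Type*) [CommRing C] [Algebra ℝ C] [AddCommGroup L] [Module ℝ L]
    [Module C L] where
  /-- the Lie bracket -/
  bracket : L →ₗ[ℝ] L →ₗ[ℝ] L
  /-- the anchor, with values in derivations -/
  anchor : L →ₗ[C] Derivation ℝ C C
  bracket_self : ∀ X, bracket X X = 0
  jacobi : ∀ X Y Z, bracket X (bracket Y Z) = bracket (bracket X Y) Z + bracket Y (bracket X Z)
  leibniz : ∀ X (f : C) Y, bracket X (f • Y) = f • bracket X Y + anchor X f • Y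
  anchor_bracket : ∀ X Y f,
    anchor (bracket X Y) f = anchor X (anchor Y f) - anchor Y (anchor X f)

variable {C L : Type*} [CommRing C] [Algebra ℝ C] [AddCommGroup L] [Module ℝ L]
  [Module C L] [IsScalarTower ℝ C L]

/-- The additive group `∧L × ∧L`, with the `C`-action `f • (P, R) = (f P, f R + P ∧ δ f)` twisted
by a derivation `δ : C → ∧L`. It serves to extend a map from `C` and `L` to all of `∧L`. -/
def Twist (_δ : Derivation ℝ C (ExteriorAlgebra C L)) : Type _ :=
  ExteriorAlgebra C L × ExteriorAlgebra C L

instance (δ : Derivation ℝ C (ExteriorAlgebra C L)) : AddCommGroup (Twist δ) :=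
  inferInstanceAs (AddCommGroup (ExteriorAlgebra C L × ExteriorAlgebra C L))

instance (δ : Derivation ℝ C (ExteriorAlgebra C L)) : Module C (Twist δ) where
  smul f p := (f • p.1, f • p.2 + p.1 * δ f)
  one_smul p := by
    change ((1 : C) • p.1, (1 : C) • p.2 + p.1 * δ 1) = (p.1, p.2)
    simp
  mul_smul f g p := by
    change ((f * g) • p.1, (f * g) • p.2 + p.1 * δ (f * g)) =
      (f • g • p.1, f • (g • p.2 + p.1 * δ g) + (g • p.1) * δ f)
    simp [mul_smul, mul_add, add_assoc]
  smul_zero f := by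
    change (f • (0 : ExteriorAlgebra C L), f • (0 : ExteriorAlgebra C L) + 0 * δ f) = 0
    simp
  smul_add f p q := by
    change (f • (p.1 + q.1), f • (p.2 + q.2) + (p.1 + q.1) * δ f) =
      (f • p.1 + f • q.1, (f • p.2 + p.1 * δ f) + (f • q.2 + q.1 * δ f))
    simp only [smul_add, add_mul, Prod.mk.injEq, true_and]
    abel
  add_smul f g p := by
    change ((f + g) • p.1, (f + g) • p.2 + p.1 * δ (f + g)) =
      (f • p.1 + g • p.1, (f • p.2 + p.1 * δ f) + (g • p.2 + p.1 * δ g))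
    simp only [add_smul, map_add, mul_add, Prod.mk.injEq, true_and]
    abel
  zero_smul p := by
    change ((0 : C) • p.1, (0 : C) • p.2 + p.1 * δ 0) = 0
    simp

/-- The grade involution turns left into right multiplication by an element of degree one. -/
theorem involute_mul_ι (P : ExteriorAlgebra C L) (X : L) :
    CliffordAlgebra.involute P * ExteriorAlgebra.ι C X = ExteriorAlgebra.ι C X * P := by
  induction P using CliffordAlgebra.left_induction with
  | algebraMap r => simp [Algebra.commutes]
  | add x y hx hy => simp [add_mul, mul_add, hx, hy]
  | ι_mul x m hx =>
    change CliffordAlgebra.involute (ExteriorAlgebra.ι C m * x) * _ =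
      _ * (ExteriorAlgebra.ι C m * x)
    have h := ExteriorAlgebra.ι_add_mul_swap (R := C) X m
    have hm : CliffordAlgebra.involute (ExteriorAlgebra.ι C m) = -ExteriorAlgebra.ι C m :=
      CliffordAlgebra.involute_ι _
    rw [map_mul, mul_assoc, hx, hm, ← mul_assoc, ← mul_assoc, eq_neg_of_add_eq_zero_left h]
    simp

/-- For `X` in `L`, the operator `(P, R) ↦ (X ∧ P, X ∧ R + (-1)^|P| P ∧ θ X)`. -/
def twistMul (δ : Derivation ℝ C (ExteriorAlgebra C L)) (θ : L →+ ExteriorAlgebra C L)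
    (hθ : ∀ (f : C) (X : L), θ (f • X) = f • θ X + ExteriorAlgebra.ι C X * δ f) :
    L →ₗ[C] Module.End C (Twist δ) where
  toFun X :=
    { toFun := fun p => (ExteriorAlgebra.ι C X * p.1,
        ExteriorAlgebra.ι C X * p.2 + CliffordAlgebra.involute p.1 * θ X)
      map_add' := fun p q => by
        change (ExteriorAlgebra.ι C X * (p.1 + q.1), ExteriorAlgebra.ι C X * (p.2 + q.2) +
            CliffordAlgebra.involute (p.1 + q.1) * θ X) =
          (ExteriorAlgebra.ι C X * p.1 + ExteriorAlgebra.ι C X * q.1,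
            (ExteriorAlgebra.ι C X * p.2 + CliffordAlgebra.involute p.1 * θ X) +
            (ExteriorAlgebra.ι C X * q.2 + CliffordAlgebra.involute q.1 * θ X))
        simp only [mul_add, add_mul, map_add, Prod.mk.injEq, true_and]
        abel
      map_smul' := fun f p => by
        change (ExteriorAlgebra.ι C X * (f • p.1), ExteriorAlgebra.ι C X * (f • p.2 + p.1 * δ f) +
            CliffordAlgebra.involute (f • p.1) * θ X) =
          (f • (ExteriorAlgebra.ι C X * p.1), f • (ExteriorAlgebra.ι C X * p.2 +
            CliffordAlgebra.involute p.1 * θ X) + ExteriorAlgebra.ι C X * p.1 * δ f)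
        simp only [mul_add, map_smul, smul_add, mul_smul_comm, smul_mul_assoc, mul_assoc,
          Prod.mk.injEq, true_and]
        abel }
  map_add' X Y := by
    refine LinearMap.ext fun p => ?_
    change (ExteriorAlgebra.ι C (X + Y) * p.1, ExteriorAlgebra.ι C (X + Y) * p.2 +
        CliffordAlgebra.involute p.1 * θ (X + Y)) =
      (ExteriorAlgebra.ι C X * p.1 + ExteriorAlgebra.ι C Y * p.1,
        (ExteriorAlgebra.ι C X * p.2 + CliffordAlgebra.involute p.1 * θ X) +
        (ExteriorAlgebra.ι C Y * p.2 + CliffordAlgebra.involute p.1 * θ Y))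
    simp only [mul_add, add_mul, map_add, Prod.mk.injEq, true_and]
    abel
  map_smul' f X := by
    refine LinearMap.ext fun p => ?_
    change (ExteriorAlgebra.ι C (f • X) * p.1, ExteriorAlgebra.ι C (f • X) * p.2 +
        CliffordAlgebra.involute p.1 * θ (f • X)) =
      (f • (ExteriorAlgebra.ι C X * p.1), f • (ExteriorAlgebra.ι C X * p.2 +
        CliffordAlgebra.involute p.1 * θ X) + ExteriorAlgebra.ι C X * p.1 * δ f)
    rw [hθ, mul_add, ← mul_assoc, involute_mul_ι]
    simp only [map_smul, smul_add, mul_smul_comm, smul_mul_assoc, Prod.mk.injEq, true_and]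
    abel

section

variable (δ : Derivation ℝ C (ExteriorAlgebra C L)) (θ : L →+ ExteriorAlgebra C L)
  (hθ : ∀ (f : C) (X : L), θ (f • X) = f • θ X + ExteriorAlgebra.ι C X * δ f)

/-- The action of `∧L` on the twisted module that `twistMul` generates. -/
def twistLift : ExteriorAlgebra C L →ₐ[C] Module.End C (Twist δ) :=
  ExteriorAlgebra.lift C ⟨twistMul δ θ hθ, fun X => by
    refine LinearMap.ext fun p => ?_
    change (ExteriorAlgebra.ι C X * (ExteriorAlgebra.ι C X * p.1),
      ExteriorAlgebra.ι C X * (ExteriorAlgebra.ι C X * p.2 +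
        CliffordAlgebra.involute p.1 * θ X) +
        CliffordAlgebra.involute (ExteriorAlgebra.ι C X * p.1) * θ X) = (0, 0)
    have hX : CliffordAlgebra.involute (ExteriorAlgebra.ι C X) = -ExteriorAlgebra.ι C X :=
      CliffordAlgebra.involute_ι _
    simp [mul_add, ← mul_assoc, hX]⟩

/-- The additive map `D : ∧L → ∧L` with `D f = δ f` for `f` in `C`, and
`D (X ∧ P) = X ∧ D P + (-1)^|P| P ∧ θ X` for `X` in `L`. -/
def gradedExtension : ExteriorAlgebra C L →+ ExteriorAlgebra C L where
  toFun P := (twistLift δ θ hθ P ((1, 0) : ExteriorAlgebra C L × ExteriorAlgebra C L)).2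
  map_zero' := by rw [map_zero]; rfl
  map_add' P Q := by rw [map_add]; rfl

theorem gradedExtension_algebraMap (f : C) :
    gradedExtension δ θ hθ (algebraMap C _ f) = δ f := by
  change (twistLift δ θ hθ (algebraMap C _ f)
    ((1, 0) : ExteriorAlgebra C L × ExteriorAlgebra C L)).2 = δ f
  rw [AlgHom.commutes]
  change f • (0 : ExteriorAlgebra C L) + 1 * δ f = δ f
  simp

theorem twistLift_fst (P : ExteriorAlgebra C L) :
    (twistLift δ θ hθ P ((1, 0) : ExteriorAlgebra C L × ExteriorAlgebra C L)).1 = P := by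
  induction P using CliffordAlgebra.left_induction with
  | algebraMap r =>
    rw [AlgHom.commutes]
    change r • (1 : ExteriorAlgebra C L) = _
    rw [Algebra.algebraMap_eq_smul_one]
  | add x y hx hy =>
    rw [map_add]
    exact congrArg₂ (· + ·) hx hy
  | ι_mul x m hx =>
    change (twistLift δ θ hθ (ExteriorAlgebra.ι C m * x)
      ((1, 0) : ExteriorAlgebra C L × ExteriorAlgebra C L)).1 = ExteriorAlgebra.ι C m * x
    rw [map_mul, twistLift, ExteriorAlgebra.lift_ι_apply]
    exact congrArg (ExteriorAlgebra.ι C m * ·) hx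

theorem gradedExtension_ι_mul (X : L) (P : ExteriorAlgebra C L) :
    gradedExtension δ θ hθ (ExteriorAlgebra.ι C X * P) =
      ExteriorAlgebra.ι C X * gradedExtension δ θ hθ P + CliffordAlgebra.involute P * θ X := by
  change (twistLift δ θ hθ (ExteriorAlgebra.ι C X * P)
      ((1, 0) : ExteriorAlgebra C L × ExteriorAlgebra C L)).2 =
    ExteriorAlgebra.ι C X * (twistLift δ θ hθ P
      ((1, 0) : ExteriorAlgebra C L × ExteriorAlgebra C L)).2 + _
  have h : twistLift δ θ hθ (ExteriorAlgebra.ι C X) = twistMul δ θ hθ X :=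
    ExteriorAlgebra.lift_ι_apply C _ _ X
  rw [map_mul, h]
  exact congrArg (fun Q => ExteriorAlgebra.ι C X * (twistLift δ θ hθ P
    ((1, 0) : ExteriorAlgebra C L × ExteriorAlgebra C L)).2 + CliffordAlgebra.involute Q * θ X)
    (twistLift_fst δ θ hθ P)

end

namespace LieRinehartStr

variable (S : LieRinehartStr C L)

/-- The operator `[X, ·]` on `∧L`: the derivation with `f ↦ a(X) f` and `Y ↦ [X, Y]`. -/
def lieDer (X : L) : ExteriorAlgebra C L →+ ExteriorAlgebra C L :=
  gradedExtension ((Algebra.linearMap C (ExteriorAlgebra C L)).compDer (S.anchor X))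
    ((ExteriorAlgebra.ι C).toAddMonoidHom.comp (S.bracket X).toAddMonoidHom) fun f Y => by
      simp [S.leibniz, Algebra.algebraMap_eq_smul_one]

/-- The differential of a function, `X ↦ a(X) f`, as a functional on `L`. -/
def dFun (f : C) : Module.Dual C L where
  toFun X := S.anchor X f
  map_add' X Y := by simp
  map_smul' g X := by simp

/-- For fixed `Q` in `∧L`, the derivation `f ↦ [f, Q] = - ι_{df} Q`. -/
def adFun (Q : ExteriorAlgebra C L) : Derivation ℝ C (ExteriorAlgebra C L) where
  toFun f := -CliffordAlgebra.contractLeft (S.dFun f) Q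
  map_add' f g := by
    have : S.dFun (f + g) = S.dFun f + S.dFun g := by ext; simp [dFun]
    rw [this, map_add, LinearMap.add_apply, neg_add]
  map_smul' r f := by
    have : S.dFun (r • f) = algebraMap ℝ C r • S.dFun f := by
      ext; simp [dFun, Algebra.smul_def]
    rw [this, map_smul, LinearMap.smul_apply, algebraMap_smul, RingHom.id_apply, smul_neg]
  map_one_eq_zero' := by
    have : S.dFun 1 = 0 := by ext; simp [dFun]
    change -CliffordAlgebra.contractLeft (S.dFun 1) Q = 0
    rw [this, map_zero, LinearMap.zero_apply, neg_zero]
  leibniz' f g := by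
    have : S.dFun (f * g) = f • S.dFun g + g • S.dFun f := by ext; simp [dFun]
    change -CliffordAlgebra.contractLeft (S.dFun (f * g)) Q =
      f • (-CliffordAlgebra.contractLeft (S.dFun g) Q) +
        g • (-CliffordAlgebra.contractLeft (S.dFun f) Q)
    rw [this, map_add, LinearMap.add_apply, map_smul, map_smul]
    simp only [LinearMap.smul_apply, smul_neg, neg_add]

theorem lieDer_algebraMap (X : L) (f : C) :
    S.lieDer X (algebraMap C _ f) = algebraMap C _ (S.anchor X f) :=
  gradedExtension_algebraMap _ _ _ f

theorem lieDer_ι_mul (X Y : L) (P : ExteriorAlgebra C L) :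
    S.lieDer X (ExteriorAlgebra.ι C Y * P) =
      ExteriorAlgebra.ι C Y * S.lieDer X P + ExteriorAlgebra.ι C (S.bracket X Y) * P := by
  rw [← involute_mul_ι P (S.bracket X Y)]
  exact gradedExtension_ι_mul (C := C) (L := L)
    ((Algebra.linearMap C (ExteriorAlgebra C L)).compDer (S.anchor X))
    ((ExteriorAlgebra.ι C).toAddMonoidHom.comp (S.bracket X).toAddMonoidHom) _ Y P

theorem bracket_swap (X Y : L) : S.bracket X Y = -S.bracket Y X := by
  have h := S.bracket_self (X + Y)
  simp only [map_add, LinearMap.add_apply, S.bracket_self, zero_add, add_zero] at h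
  exact eq_neg_of_add_eq_zero_right h

theorem lieDer_add (X Y : L) (P : ExteriorAlgebra C L) :
    S.lieDer (X + Y) P = S.lieDer X P + S.lieDer Y P := by
  induction P using CliffordAlgebra.left_induction with
  | algebraMap r =>
    change S.lieDer (X + Y) (algebraMap C (ExteriorAlgebra C L) r) =
      S.lieDer X (algebraMap C (ExteriorAlgebra C L) r) +
      S.lieDer Y (algebraMap C (ExteriorAlgebra C L) r)
    simp [lieDer_algebraMap]
  | add x y hx hy => rw [map_add, map_add, map_add, hx, hy]; abel
  | ι_mul x m hx =>
    change S.lieDer (X + Y) (ExteriorAlgebra.ι C m * x) =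
      S.lieDer X (ExteriorAlgebra.ι C m * x) + S.lieDer Y (ExteriorAlgebra.ι C m * x)
    simp only [lieDer_ι_mul, hx, map_add, LinearMap.add_apply, mul_add, add_mul]
    abel

theorem lieDer_smul (f : C) (X : L) (P : ExteriorAlgebra C L) :
    S.lieDer (f • X) P = f • S.lieDer X P + ExteriorAlgebra.ι C X * S.adFun P f := by
  change _ = f • S.lieDer X P +
    ExteriorAlgebra.ι C X * -CliffordAlgebra.contractLeft (S.dFun f) P
  induction P using CliffordAlgebra.left_induction with
  | algebraMap r =>
    change S.lieDer (f • X) (algebraMap C (ExteriorAlgebra C L) r) =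
      f • S.lieDer X (algebraMap C (ExteriorAlgebra C L) r) + _
    rw [CliffordAlgebra.contractLeft_algebraMap]
    simp [lieDer_algebraMap, Algebra.smul_def]
  | add x y hx hy =>
    rw [map_add, map_add, map_add, hx, hy, smul_add, neg_add, mul_add]; abel
  | ι_mul x m hx =>
    have hb : S.bracket (f • X) m = f • S.bracket X m - S.anchor m f • X := by
      rw [S.bracket_swap, S.leibniz, S.bracket_swap m X, smul_neg, neg_add, neg_neg,
        sub_eq_add_neg]
    change S.lieDer (f • X) (ExteriorAlgebra.ι C m * x) =
      f • S.lieDer X (ExteriorAlgebra.ι C m * x) + _ *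
        -CliffordAlgebra.contractLeft (S.dFun f) (CliffordAlgebra.ι _ m * x)
    rw [CliffordAlgebra.contractLeft_ι_mul, lieDer_ι_mul, lieDer_ι_mul, hx, hb]
    have hs : ExteriorAlgebra.ι C m * ExteriorAlgebra.ι C X =
        -(ExteriorAlgebra.ι C X * ExteriorAlgebra.ι C m) :=
      eq_neg_of_add_eq_zero_left (ExteriorAlgebra.ι_add_mul_swap m X)
    change _ = _ + ExteriorAlgebra.ι C X * -(S.anchor m f • x - ExteriorAlgebra.ι C m * _)
    simp only [map_sub, map_smul, mul_add, mul_neg, sub_mul, mul_sub, ← mul_assoc, hs,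
      neg_mul, neg_neg, neg_sub, smul_add, mul_smul_comm, smul_mul_assoc]
    abel

/-- The Gerstenhaber (Schouten) bracket `[P, Q]` on `∧L`, for arbitrary (also inhomogeneous) `P`
and `Q`. It satisfies `[f, Q] = - ι_{df} Q` for `f` in `C`, it restricts on `L` to the bracket, with
`[X, f] = a(X) f`, and `[X ∧ P, Q] = X ∧ [P, Q] + (-1)^|P| P ∧ [X, Q]`. -/
def schouten (P Q : ExteriorAlgebra C L) : ExteriorAlgebra C L :=
  gradedExtension (S.adFun Q)
    { toFun := fun X => S.lieDer X Q
      map_zero' := by simpa using S.lieDer_smul 0 0 Q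
      map_add' := fun X Y => S.lieDer_add X Y Q }
    (fun f X => S.lieDer_smul f X Q) P

theorem schouten_algebraMap (f : C) (Q : ExteriorAlgebra C L) :
    S.schouten (algebraMap C _ f) Q = -CliffordAlgebra.contractLeft (S.dFun f) Q :=
  gradedExtension_algebraMap _ _ _ f

theorem schouten_ι_mul (X : L) (P Q : ExteriorAlgebra C L) :
    S.schouten (ExteriorAlgebra.ι C X * P) Q =
      ExteriorAlgebra.ι C X * S.schouten P Q + CliffordAlgebra.involute P * S.lieDer X Q :=
  gradedExtension_ι_mul _ _ _ X P

theorem schouten_ι (X : L) (Q : ExteriorAlgebra C L) :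
    S.schouten (ExteriorAlgebra.ι C X) Q = S.lieDer X Q := by
  have h1 : S.schouten 1 Q = 0 := by
    have h := S.schouten_algebraMap 1 Q
    have : S.dFun 1 = 0 := by ext; simp [dFun]
    rwa [this, map_one, map_zero, LinearMap.zero_apply, neg_zero] at h
  have h := S.schouten_ι_mul X 1 Q
  rw [h1] at h
  simpa using h

end LieRinehartStr

/-- `d` is an `ℝ`-linear derivation of degree `+1` of the graded algebra `∧L`. -/
structure IsDegreeOneDerivation (d : ExteriorAlgebra C L → ExteriorAlgebra C L) : Prop where
  map_add : ∀ P Q, d (P + Q) = d P + d Q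
  map_smul : ∀ (r : ℝ) P, d (r • P) = r • d P
  degree : ∀ (p : ℕ) (P : ExteriorAlgebra C L), P ∈ ⋀[C]^p L → d P ∈ ⋀[C]^(p + 1) L
  leibniz : ∀ (p : ℕ) (P Q : ExteriorAlgebra C L), P ∈ ⋀[C]^p L →
    d (P * Q) = d P * Q + (-1) ^ p * (P * d Q)

/-- `d` is a derivation of degree `+1` of the Gerstenhaber algebra `∧L`: a derivation of the
product and of the bracket, the latter having degree `-1`. -/
structure LieRinehartStr.IsGerstenhaberDerivation (S : LieRinehartStr C L)
    (d : ExteriorAlgebra C L → ExteriorAlgebra C L) : Prop extends IsDegreeOneDerivation d where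
  bracket : ∀ (p : ℕ) (P Q : ExteriorAlgebra C L), P ∈ ⋀[C]^p L →
    d (S.schouten P Q) = S.schouten (d P) Q + (-1) ^ (p + 1) * S.schouten P (d Q)

end Algebra

/-! ## The Cartan trivector of a quadratic Lie algebra -/

section Quadratic

variable {𝔤 : Type*} [LieRing 𝔤] [LieAlgebra ℝ 𝔤] [FiniteDimensional ℝ 𝔤]

/-- The trivector `φ = 1/12 ∑ ⟨e^i, [e^j, e^k]⟩ e_i ∧ e_j ∧ e_k` in `∧³ 𝔤`, for dual bases `e_i` and
`e^i`, where `⟨·,·⟩ = B` (the choice of the basis does not matter). As an alternating form on `𝔤*` it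
is `φ(α, β, γ) = 1/2 α([β♯, γ♯])`, where `⟨β♯, ·⟩ = β`. -/
def cartanTrivector (B : LinearMap.BilinForm ℝ 𝔤) (hB : B.Nondegenerate) : ExteriorAlgebra ℝ 𝔤 :=
  let e := Module.finBasis ℝ 𝔤
  let e' := B.dualBasis hB e
  (1 / 12 : ℝ) • ∑ i, ∑ j, ∑ k, B (e' i) ⁅e' j, e' k⁆ •
    (ExteriorAlgebra.ι ℝ (e i) * ExteriorAlgebra.ι ℝ (e j) * ExteriorAlgebra.ι ℝ (e k))

end Quadratic

/-! ## Lie algebroids -/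

section Geometry

variable {E : Type*} [NormedAddCommGroup E] [NormedSpace ℝ E]
  {M : Type*} [TopologicalSpace M] [ChartedSpace E M]

section Sections

variable {F : Type*} [NormedAddCommGroup F] [NormedSpace ℝ F]
  {V : M → Type*} [TopologicalSpace (Bundle.TotalSpace F V)] [∀ x, TopologicalSpace (V x)]
  [FiberBundle F V] [∀ x, AddCommGroup (V x)] [∀ x, Module ℝ (V x)] [VectorBundle ℝ F V]

/-- Smooth sections form a module over smooth functions. -/
instance sectionModule : Module C^∞⟮𝓘(ℝ, E), M; ℝ⟯ Cₛ^∞⟮𝓘(ℝ, E); F, V⟯ where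
  smul f s := ⟨(fun x => f x) • (fun x => s x), f.contMDiff.smul_section s.contMDiff⟩
  one_smul s := by ext x; exact one_smul ℝ (s x)
  mul_smul f g s := by ext x; exact mul_smul (f x) (g x) (s x)
  smul_zero f := by ext x; exact smul_zero (f x)
  smul_add f s t := by ext x; exact smul_add (f x) (s x) (t x)
  add_smul f g s := by ext x; exact add_smul (f x) (g x) (s x)
  zero_smul s := by ext x; exact zero_smul ℝ (s x)

theorem section_smul_apply (f : C^∞⟮𝓘(ℝ, E), M; ℝ⟯) (s : Cₛ^∞⟮𝓘(ℝ, E); F, V⟯) (x : M) :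
    (f • s) x = f x • s x := rfl

instance sectionTower :
    IsScalarTower ℝ C^∞⟮𝓘(ℝ, E), M; ℝ⟯ Cₛ^∞⟮𝓘(ℝ, E); F, V⟯ where
  smul_assoc r f s := by ext x; exact smul_assoc r (f x) (s x)

end Sections

variable [IsManifold 𝓘(ℝ, E) ∞ M]

/-- The derivative `v f` of smooth functions along a smooth vector field `v`. -/
def vfDeriv (v : Cₛ^∞⟮𝓘(ℝ, E); E, (TangentSpace 𝓘(ℝ, E) : M → Type _)⟯) :
    Derivation ℝ C^∞⟮𝓘(ℝ, E), M; ℝ⟯ C^∞⟮𝓘(ℝ, E), M; ℝ⟯ where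
  toFun f := ⟨fun x => mvfderiv 𝓘(ℝ, E) f x (v x), by
    have h1 := f.contMDiff.contMDiff_tangentMap (m := ∞) (by simp)
    have h2 := h1.comp v.contMDiff
    intro x
    have h3 := (Bundle.contMDiffAt_totalSpace.1 (h2 x)).2
    simpa [tangentMap] using! h3⟩
  map_add' f g := by
    ext x
    change mvfderiv 𝓘(ℝ, E) (f + g : M → ℝ) x (v x) = _
    rw [mvfderiv_add f.mdifferentiableAt g.mdifferentiableAt]
    rfl
  map_smul' r f := by
    ext x
    change mvfderiv 𝓘(ℝ, E) ((fun _ : M => r) • f : M → ℝ) x (v x) = r * mvfderiv 𝓘(ℝ, E) f x (v x)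
    rw [mvfderiv_smul mdifferentiableAt_const f.mdifferentiableAt]
    simp [mvfderiv, mfderiv_const]
  map_one_eq_zero' := by
    ext x
    change mvfderiv 𝓘(ℝ, E) (fun _ : M => (1 : ℝ)) x (v x) = 0
    simp [mvfderiv, mfderiv_const]
  leibniz' f g := by
    ext x
    change mvfderiv 𝓘(ℝ, E) (f * g : M → ℝ) x (v x) = _
    rw [mvfderiv_mul f.mdifferentiableAt g.mdifferentiableAt]
    rfl

section HomBundles

variable {F : Type*} [NormedAddCommGroup F] [NormedSpace ℝ F]
  {V : M → Type*} [TopologicalSpace (Bundle.TotalSpace F V)] [∀ x, TopologicalSpace (V x)]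
  [FiberBundle F V] [∀ x, AddCommGroup (V x)] [∀ x, Module ℝ (V x)] [VectorBundle ℝ F V]

/-- The image of a section of `V` under a smooth bundle map `V → TM`. -/
def bundleMapApply
    (a : Cₛ^∞⟮𝓘(ℝ, E); F →L[ℝ] E, fun x : M => V x →L[ℝ] TangentSpace 𝓘(ℝ, E) x⟯)
    (X : Cₛ^∞⟮𝓘(ℝ, E); F, V⟯) :
    Cₛ^∞⟮𝓘(ℝ, E); E, (TangentSpace 𝓘(ℝ, E) : M → Type _)⟯ :=
  ⟨fun x => a x (X x), fun x => (a.contMDiff x).clm_bundle_apply (X.contMDiff x)⟩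

variable (E F V) in
/-- A Lie algebroid structure on the vector bundle `V → M`: a Lie bracket on the space of smooth
sections, and a smooth bundle map `V → TM`, the anchor, which satisfies the Leibniz rule and
preserves brackets (with vector fields acting as derivations on functions). -/
structure LieAlgebroid where
  /-- the bracket of sections -/
  bracket : Cₛ^∞⟮𝓘(ℝ, E); F, V⟯ →ₗ[ℝ] Cₛ^∞⟮𝓘(ℝ, E); F, V⟯ →ₗ[ℝ] Cₛ^∞⟮𝓘(ℝ, E); F, V⟯
  /-- the anchor map -/
  anchor : Cₛ^∞⟮𝓘(ℝ, E); F →L[ℝ] E, fun x : M => V x →L[ℝ] TangentSpace 𝓘(ℝ, E) x⟯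
  bracket_self : ∀ X, bracket X X = 0
  jacobi : ∀ X Y Z, bracket X (bracket Y Z) = bracket (bracket X Y) Z + bracket Y (bracket X Z)
  leibniz : ∀ X (f : C^∞⟮𝓘(ℝ, E), M; ℝ⟯) Y,
    bracket X (f • Y) = f • bracket X Y + vfDeriv (bundleMapApply anchor X) f • Y
  anchor_bracket : ∀ X Y f, vfDeriv (bundleMapApply anchor (bracket X Y)) f =
    vfDeriv (bundleMapApply anchor X) (vfDeriv (bundleMapApply anchor Y) f) -
      vfDeriv (bundleMapApply anchor Y) (vfDeriv (bundleMapApply anchor X) f)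

/-- The vector field `a(X)`. -/
def LieAlgebroid.anchorField (𝓐 : LieAlgebroid E F V) (X : Cₛ^∞⟮𝓘(ℝ, E); F, V⟯) :
    Cₛ^∞⟮𝓘(ℝ, E); E, (TangentSpace 𝓘(ℝ, E) : M → Type _)⟯ :=
  bundleMapApply 𝓐.anchor X

/-- The Lie-Rinehart structure on the sections of a Lie algebroid. -/
def LieAlgebroid.toLieRinehart (𝓐 : LieAlgebroid E F V) :
    LieRinehartStr C^∞⟮𝓘(ℝ, E), M; ℝ⟯ Cₛ^∞⟮𝓘(ℝ, E); F, V⟯ where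
  bracket := 𝓐.bracket
  anchor :=
    { toFun := fun X => vfDeriv (𝓐.anchorField X)
      map_add' := fun X Y => by
        ext f x
        exact congrArg (mvfderiv 𝓘(ℝ, E) f x) (map_add (𝓐.anchor x) (X x) (Y x)) |>.trans
          (map_add _ _ _)
      map_smul' := fun g X => by
        ext f x
        exact congrArg (mvfderiv 𝓘(ℝ, E) f x) (map_smul (𝓐.anchor x) (g x) (X x)) |>.trans
          (map_smul _ _ _) }
  bracket_self := 𝓐.bracket_self
  jacobi := 𝓐.jacobi
  leibniz := 𝓐.leibniz
  anchor_bracket := 𝓐.anchor_bracket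

/-- The algebra `Γ(∧V)`, as the exterior algebra over `C^∞(M)` of the module `Γ(V)`. (The sections
of a vector bundle over a manifold form a finitely generated projective module, so this is
canonically the algebra of smooth sections of the bundle `∧V`.) -/
abbrev ExteriorSections (E : Type*) [NormedAddCommGroup E] [NormedSpace ℝ E]
    {M : Type*} [TopologicalSpace M] [ChartedSpace E M]
    (F : Type*) [NormedAddCommGroup F] [NormedSpace ℝ F]
    (V : M → Type*) [TopologicalSpace (Bundle.TotalSpace F V)] [∀ x, TopologicalSpace (V x)]
    [FiberBundle F V] [∀ x, AddCommGroup (V x)] [∀ x, Module ℝ (V x)] [VectorBundle ℝ F V] :=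
  ExteriorAlgebra C^∞⟮𝓘(ℝ, E), M; ℝ⟯ Cₛ^∞⟮𝓘(ℝ, E); F, V⟯

/-- The dual bundle `V*`. -/
abbrev DualBundle (V : M → Type*) [∀ x, TopologicalSpace (V x)] [∀ x, AddCommGroup (V x)]
    [∀ x, Module ℝ (V x)] : M → Type _ :=
  fun x => V x →L[ℝ] Bundle.Trivial M ℝ x

/-- The pairing `⟨α, X⟩` of a section of `V*` with a section of `V`, as a functional of `X`. -/
def pairing (α : Cₛ^∞⟮𝓘(ℝ, E); F →L[ℝ] ℝ, DualBundle V⟯) :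
    Module.Dual C^∞⟮𝓘(ℝ, E), M; ℝ⟯ Cₛ^∞⟮𝓘(ℝ, E); F, V⟯ where
  toFun X := ⟨fun x => α x (X x), fun x => by
    have h := (α.contMDiff x).clm_bundle_apply (X.contMDiff x)
    simpa using! (Bundle.contMDiffAt_totalSpace.1 h).2⟩
  map_add' X Y := by ext x; exact map_add (α x) (X x) (Y x)
  map_smul' f X := by ext x; exact map_smul (α x) (f x) (X x)

/-- The value `P(α)` of the degree-one part of `P` in `Γ(∧V)` on a section of `V*`. -/
def eval₁ (P : ExteriorSections E F V) (α : Cₛ^∞⟮𝓘(ℝ, E); F →L[ℝ] ℝ, DualBundle V⟯) :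
    C^∞⟮𝓘(ℝ, E), M; ℝ⟯ :=
  ExteriorAlgebra.algebraMapInv (CliffordAlgebra.contractLeft (pairing α) P)

/-- The value `P(α, β)` of the degree-two part of `P` in `Γ(∧V)` on sections of `V*`; thus
`(X ∧ Y)(α, β) = α(X) β(Y) - α(Y) β(X)`. -/
def eval₂ (P : ExteriorSections E F V) (α β : Cₛ^∞⟮𝓘(ℝ, E); F →L[ℝ] ℝ, DualBundle V⟯) :
    C^∞⟮𝓘(ℝ, E), M; ℝ⟯ :=
  ExteriorAlgebra.algebraMapInv
    (CliffordAlgebra.contractLeft (pairing β) (CliffordAlgebra.contractLeft (pairing α) P))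

/-- `d` is the differential on `Γ(∧V)` of the Lie algebroid structure `𝓑` on `V*`: it is a
derivation of degree `+1` with square zero, and in degrees `0` and `1` it is given by
`(d f)(α) = a(α) f` and `(d X)(α, β) = a(α) β(X) - a(β) α(X) - [α, β](X)`. (A derivation is
determined by its values in degrees `0` and `1`.) -/
structure IsDifferentialOfDual (𝓑 : LieAlgebroid E (F →L[ℝ] ℝ) (DualBundle V))
    (d : ExteriorSections E F V → ExteriorSections E F V) : Prop
    extends IsDegreeOneDerivation d where
  sq_zero : ∀ P, d (d P) = 0
  apply_fun : ∀ (f : C^∞⟮𝓘(ℝ, E), M; ℝ⟯) α,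
    eval₁ (d (algebraMap _ _ f)) α = vfDeriv (𝓑.anchorField α) f
  apply_section : ∀ X α β,
    eval₂ (d (ExteriorAlgebra.ι _ X)) α β =
      vfDeriv (𝓑.anchorField α) (pairing β X) - vfDeriv (𝓑.anchorField β) (pairing α X) -
        pairing (𝓑.bracket α β) X

/-- A fibrewise linear map `μ : V → 𝔤` is a morphism of Lie algebroids, where the Lie algebra `𝔤` is
a Lie algebroid over a point: it is smooth, and
`μ [s, t] = a(s) (μ t) - a(t) (μ s) + [μ s, μ t]` for all sections `s` and `t`, as functions from
`M` to `𝔤` (this is written out in components, after applying a linear form `l` on `𝔤`). -/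
structure IsMorphismToLieAlgebra {𝔤 : Type*} [LieRing 𝔤] [LieAlgebra ℝ 𝔤]
    (𝓑 : LieAlgebroid E F V) (μ : ∀ x, V x →ₗ[ℝ] 𝔤) : Prop where
  smooth : ∀ (l : Module.Dual ℝ 𝔤) (s : Cₛ^∞⟮𝓘(ℝ, E); F, V⟯),
    ContMDiff 𝓘(ℝ, E) 𝓘(ℝ, ℝ) ∞ fun x => l (μ x (s x))
  map_bracket : ∀ (l : Module.Dual ℝ 𝔤) (s t : Cₛ^∞⟮𝓘(ℝ, E); F, V⟯) (x : M),
    l (μ x (𝓑.bracket s t x)) =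
      mvfderiv 𝓘(ℝ, E) (fun y => l (μ y (t y))) x (𝓑.anchor x (s x)) -
      mvfderiv 𝓘(ℝ, E) (fun y => l (μ y (s y))) x (𝓑.anchor x (t x)) +
      l ⁅μ x (s x), μ x (t x)⁆

end HomBundles

/-! ## Quasi-Poisson bialgebroids -/

variable (E M) in
/-- The structure of a `𝔤`-manifold on `M`: a morphism of Lie algebras from `𝔤` to vector fields,
where vector fields act as derivations on functions. -/
structure InfinitesimalAction (𝔤 : Type*) [LieRing 𝔤] [LieAlgebra ℝ 𝔤] where
  /-- the vector fields that generate the action -/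
  field : 𝔤 →ₗ[ℝ] Cₛ^∞⟮𝓘(ℝ, E); E, (TangentSpace 𝓘(ℝ, E) : M → Type _)⟯
  field_lie : ∀ ξ η f, vfDeriv (field ⁅ξ, η⁆) f =
    vfDeriv (field ξ) (vfDeriv (field η) f) - vfDeriv (field η) (vfDeriv (field ξ) f)

variable {F : Type*} [NormedAddCommGroup F] [NormedSpace ℝ F]
  {A : M → Type*} [TopologicalSpace (Bundle.TotalSpace F A)] [∀ x, TopologicalSpace (A x)]
  [FiberBundle F A] [∀ x, AddCommGroup (A x)] [∀ x, Module ℝ (A x)] [VectorBundle ℝ F A]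
  {𝔤 : Type*} [LieRing 𝔤] [LieAlgebra ℝ 𝔤]

/-- The extension `∧𝔤 → Γ(∧A)` of a linear map `ρ : 𝔤 → Γ(A)` to a morphism of algebras. -/
def extendExterior (ρ : 𝔤 →ₗ[ℝ] Cₛ^∞⟮𝓘(ℝ, E); F, A⟯) :
    ExteriorAlgebra ℝ 𝔤 →ₐ[ℝ] ExteriorSections E F A :=
  ExteriorAlgebra.lift ℝ
    ⟨(ExteriorAlgebra.ι C^∞⟮𝓘(ℝ, E), M; ℝ⟯).restrictScalars ℝ ∘ₗ ρ,
      fun ξ => ExteriorAlgebra.ι_sq_zero (R := C^∞⟮𝓘(ℝ, E), M; ℝ⟯) (ρ ξ)⟩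

variable (F A) in
/-- A quasi-Poisson `𝔤`-bialgebroid structure on the vector bundle `A` over the `𝔤`-manifold `M`,
where `𝔤` carries the inner product `B`.

A vector bundle map from `M × 𝔤` to `A` is determined by its values on constant sections, that is,
by a linear map `ρ : 𝔤 → Γ(A)`. It is a morphism from the action Lie algebroid to `A` if and only if
`ρ` preserves brackets and the anchor takes `ρ ξ` to the vector field that `ξ` generates. -/
structure QuasiPoissonBialgebroid [FiniteDimensional ℝ 𝔤] (B : LinearMap.BilinForm ℝ 𝔤)
    (hB : B.Nondegenerate) (act : InfinitesimalAction E M 𝔤) where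
  /-- the Lie algebroid structure of `A` -/
  algebroid : LieAlgebroid E F A
  /-- the morphism `M × 𝔤 → A`, on constant sections -/
  ρ : 𝔤 →ₗ[ℝ] Cₛ^∞⟮𝓘(ℝ, E); F, A⟯
  ρ_lie : ∀ ξ η, ρ ⁅ξ, η⁆ = algebroid.bracket (ρ ξ) (ρ η)
  anchor_ρ : ∀ ξ, algebroid.anchorField (ρ ξ) = act.field ξ
  /-- the derivation of `Γ(∧A)` -/
  𝒟 : ExteriorSections E F A → ExteriorSections E F A
  derivation : algebroid.toLieRinehart.IsGerstenhaberDerivation 𝒟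
  𝒟_ρ : ∀ ξ, 𝒟 (ExteriorAlgebra.ι _ (ρ ξ)) = 0
  𝒟_sq : ∀ P, 𝒟 (𝒟 P) =
    (1 / 2 : ℝ) • algebroid.toLieRinehart.schouten (extendExterior ρ (cartanTrivector B hB)) P

namespace QuasiPoissonBialgebroid

variable [FiniteDimensional ℝ 𝔤] {B : LinearMap.BilinForm ℝ 𝔤} {hB : B.Nondegenerate}
  {act : InfinitesimalAction E M 𝔤} (Q : QuasiPoissonBialgebroid F A B hB act)

/-- The operator `𝒟 + 1/2 ∑ ρ(e^i) ∧ [ρ(e_i), ·]` on `Γ(∧A)`, for a basis `e_i` of `𝔤` with dual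
basis `e^i`. -/
def dualDifferential {ι : Type*} [Fintype ι] [DecidableEq ι] (e : Module.Basis ι ℝ 𝔤)
    (P : ExteriorSections E F A) : ExteriorSections E F A :=
  Q.𝒟 P + (1 / 2 : ℝ) • ∑ i, ExteriorAlgebra.ι _ (Q.ρ (B.dualBasis hB e i)) *
    Q.algebroid.toLieRinehart.schouten (ExteriorAlgebra.ι _ (Q.ρ (e i))) P

/-- The map `μ_ρ : A* → 𝔤`, with `⟨μ_ρ(α), ξ⟩ = α(ρ(ξ))`. -/
def μ (x : M) : DualBundle A x →ₗ[ℝ] 𝔤 :=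
  (B.toDual hB).symm.toLinearMap ∘ₗ
    LinearMap.mk₂ ℝ (fun (α : DualBundle A x) (ξ : 𝔤) => (α (Q.ρ ξ x) : ℝ))
      (fun _ _ _ => rfl) (fun _ _ _ => rfl)
      (fun α ξ η => by rw [map_add]; exact map_add α _ _)
      (fun r α ξ => by rw [map_smul]; exact map_smul α r _)

/-- `𝓛` is the action of `𝔤` on sections of `A*` that is dual to the action `[ρ(ξ), ·]` on sections
of `A`: `(𝓛_ξ α)(X) = ξ · α(X) - α([ρ(ξ), X])`. -/
structure IsDualAction
    (𝓛 : 𝔤 →ₗ[ℝ] Module.End ℝ Cₛ^∞⟮𝓘(ℝ, E); F →L[ℝ] ℝ, DualBundle A⟯) : Prop where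
  lie : ∀ ξ η α, 𝓛 ⁅ξ, η⁆ α = 𝓛 ξ (𝓛 η α) - 𝓛 η (𝓛 ξ α)
  pairing : ∀ ξ α X, pairing (𝓛 ξ α) X =
    vfDeriv (act.field ξ) (pairing α X) - pairing α (Q.algebroid.bracket (Q.ρ ξ) X)

end QuasiPoissonBialgebroid

variable {V : M → Type*} [TopologicalSpace (Bundle.TotalSpace F V)] [∀ x, TopologicalSpace (V x)]
  [FiberBundle F V] [∀ x, AddCommGroup (V x)] [∀ x, Module ℝ (V x)] [VectorBundle ℝ F V]

/-- The action `𝓛` of `𝔤` on sections of a Lie algebroid over the `𝔤`-manifold `M` preserves the Lie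
algebroid structure: it acts by derivations of the bracket, and the anchor is equivariant. -/
structure ActionPreserves (𝓑 : LieAlgebroid E F V) (act : InfinitesimalAction E M 𝔤)
    (𝓛 : 𝔤 →ₗ[ℝ] Module.End ℝ Cₛ^∞⟮𝓘(ℝ, E); F, V⟯) : Prop where
  bracket : ∀ ξ s t, 𝓛 ξ (𝓑.bracket s t) = 𝓑.bracket (𝓛 ξ s) t + 𝓑.bracket s (𝓛 ξ t)
  anchor : ∀ ξ s f, vfDeriv (𝓑.anchorField (𝓛 ξ s)) f =
    vfDeriv (act.field ξ) (vfDeriv (𝓑.anchorField s) f) -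
      vfDeriv (𝓑.anchorField s) (vfDeriv (act.field ξ) f)

end Geometry

end QuasiPoisson

end

open scoped Manifold ContDiff Bundle

set_option linter.unusedSectionVars false

noncomputable section

namespace QuasiPoisson

section

section DualLieRinehart

variable {C L : Type*} [CommRing C] [Algebra ℝ C] [AddCommGroup L] [Module ℝ L]
  [Module C L] [IsScalarTower ℝ C L]

/-! ## Derivations of degree zero and contractions -/

/-! The proof is algebra on `∧L`, for `L` the module of sections, followed by a passage from modules
back to bundles.

A degree-one derivation `d` of `∧L` gives, for each linear form `α`, the Lie derivative `L_α = ι_α d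
+ d ι_α`, a derivation of degree zero. The bracket on `L*` is the derived bracket `ι_{[α,β]} = [L_α,
ι_β]` (`op_mul_contr`), and the anchor is `L_α` on functions. If `d² = 0`, then `L_{[α,β]} = [L_α,
L_β]` (`op_lie_dual`). Since `ι` is injective, the Jacobi identity becomes the one for commutators
of operators. A derivation commuting with `d` acts by derivations of this bracket for the same
reason (`dual_lie_dual`).

It remains to see that `d = 𝒟 + ½K`, with `K = ∑ ρ(e^i) ∧ [ρ(e_i), ·]`, squares to zero. Because
`𝒟ρ(ξ) = 0`, the operators `𝒟` and `K` anticommute. Invariance of `∑ e^i ⊗ e_i` gives `K² = -½c`,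
where `c = ∑ ρ(e^i) ∧ ρ(e^j) ∧ [ρ([e_i,e_j]), ·]` (`casimir_casimir`), and the trivector gives `𝒟² =
c/8` (`schouten_cartan`). Hence `d² = c/8 - c/8 = 0`. The same invariance makes `d` commute with
`[ρ(ξ), ·]`, which is the second claim. The third is the value of `d ρ(ξ) = ½ ∑ ρ(e^i) ∧ ρ([e_i,
ξ])` on two sections of `A*` (`eval₂_dualDifferential_ρ`).

Three facts turn the algebraic structure on `L*` into a Lie algebroid: `C^∞(M)`-linear maps of
sections are bundle maps (`exists_bundleMap`), so linear forms on sections are sections of `A*`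
(`pairingEquiv`), and derivations of `C^∞(M)` are vector fields (`vfDeriv_surjective`). -/

/-- Contraction with a linear form, as an operator on `∧L`. -/
def contr (α : Module.Dual C L) : AddMonoid.End (ExteriorAlgebra C L) :=
  (CliffordAlgebra.contractLeft (Q := (0 : QuadraticForm C L)) α).toAddMonoidHom

theorem contr_apply (α : Module.Dual C L) (P : ExteriorAlgebra C L) :
    contr α P = CliffordAlgebra.contractLeft α P := rfl

theorem contr_algebraMap (α : Module.Dual C L) (f : C) :
    contr α (algebraMap C (ExteriorAlgebra C L) f) = 0 :=
  CliffordAlgebra.contractLeft_algebraMap _ _ _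

theorem contr_ι (α : Module.Dual C L) (X : L) :
    contr α (ExteriorAlgebra.ι C X) = algebraMap C (ExteriorAlgebra C L) (α X) :=
  CliffordAlgebra.contractLeft_ι _ _ _

theorem contr_ι_mul (α : Module.Dual C L) (X : L) (P : ExteriorAlgebra C L) :
    contr α (ExteriorAlgebra.ι C X * P) = α X • P - ExteriorAlgebra.ι C X * contr α P :=
  CliffordAlgebra.contractLeft_ι_mul _ _ _

theorem contr_smul_apply (α : Module.Dual C L) (f : C) (P : ExteriorAlgebra C L) :
    contr α (f • P) = f • contr α P :=
  map_smul (CliffordAlgebra.contractLeft (Q := (0 : QuadraticForm C L)) α) f P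

theorem contr_smul (α : Module.Dual C L) (f : C) (P : ExteriorAlgebra C L) :
    contr (f • α) P = f • contr α P := by
  simp [contr_apply]

theorem contr_add (α β : Module.Dual C L) : contr (α + β) = contr α + contr β := by
  refine AddMonoidHom.ext fun P => ?_
  change contr (α + β) P = contr α P + contr β P
  simp [contr_apply]

theorem contr_contr (α : Module.Dual C L) (P : ExteriorAlgebra C L) :
    contr α (contr α P) = 0 :=
  CliffordAlgebra.contractLeft_contractLeft _ _

/-- A form is recovered from its contraction with degree-one elements. This allows identities
between linear forms to be checked as identities between operators. -/
theorem contr_injective :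
    Function.Injective (contr : Module.Dual C L → AddMonoid.End (ExteriorAlgebra C L)) := by
  intro α β h
  ext X
  have := DFunLike.congr_fun h (ExteriorAlgebra.ι C X)
  rw [contr_ι, contr_ι] at this
  exact ExteriorAlgebra.algebraMap_leftInverse L |>.injective this

theorem mem_exteriorPower_one {P : ExteriorAlgebra C L} :
    P ∈ ⋀[C]^1 L ↔ ∃ X, ExteriorAlgebra.ι C X = P := by
  rw [ExteriorAlgebra.exteriorPower, pow_one, LinearMap.mem_range]

theorem ι_mem_exteriorPower_one (X : L) : ExteriorAlgebra.ι C X ∈ ⋀[C]^1 L :=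
  mem_exteriorPower_one.2 ⟨X, rfl⟩

theorem algebraMap_mem_exteriorPower_zero (f : C) :
    algebraMap C (ExteriorAlgebra C L) f ∈ ⋀[C]^0 L := by
  rw [ExteriorAlgebra.exteriorPower, pow_zero]
  exact Submodule.algebraMap_mem f

theorem contr_mem_of_mem_two (α : Module.Dual C L) {P : ExteriorAlgebra C L} (hP : P ∈ ⋀[C]^2 L) :
    contr α P ∈ ⋀[C]^1 L := by
  rw [ExteriorAlgebra.exteriorPower, pow_two] at hP
  refine Submodule.mul_induction_on hP ?_ fun P Q hP hQ => ?_
  · rintro _ ⟨X, rfl⟩ _ ⟨Y, rfl⟩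
    rw [contr_ι_mul, contr_ι, ← Algebra.commutes, ← Algebra.smul_def]
    exact Submodule.sub_mem _ (Submodule.smul_mem _ _ (ι_mem_exteriorPower_one Y))
      (Submodule.smul_mem _ _ (ι_mem_exteriorPower_one X))
  · rw [map_add]
    exact Submodule.add_mem _ hP hQ

/-- Contraction is an odd derivation, and no sign arises when it passes an element of degree two.
Only this case is needed, for `P = dX`. -/
theorem contr_mul_of_mem_two (α : Module.Dual C L) {P : ExteriorAlgebra C L} (hP : P ∈ ⋀[C]^2 L)
    (Q : ExteriorAlgebra C L) : contr α (P * Q) = contr α P * Q + P * contr α Q := by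
  rw [ExteriorAlgebra.exteriorPower, pow_two] at hP
  refine Submodule.mul_induction_on hP ?_ fun P Q hP hQ => ?_
  · rintro _ ⟨X, rfl⟩ _ ⟨Y, rfl⟩
    rw [mul_assoc, contr_ι_mul, contr_ι_mul, contr_ι_mul, contr_ι]
    simp only [mul_sub, sub_mul, mul_assoc, Algebra.smul_def, Algebra.commutes]
    abel
  · rw [add_mul, map_add, hP, hQ, map_add, add_mul, add_mul]
    abel

variable (C L) in
/-- A derivation of degree zero of the algebra `∧L`: an operator together with its restrictions to
`C` and `L`. -/
structure ZeroDerivation where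
  op : AddMonoid.End (ExteriorAlgebra C L)
  fn : Derivation ℝ C C
  vec : L → L
  op_algebraMap : ∀ f, op (algebraMap C _ f) = algebraMap C _ (fn f)
  op_ι_mul : ∀ X P, op (ExteriorAlgebra.ι C X * P) =
    ExteriorAlgebra.ι C (vec X) * P + ExteriorAlgebra.ι C X * op P

namespace ZeroDerivation

variable (D D' : ZeroDerivation C L)

theorem op_one : D.op 1 = 0 := by
  have := D.op_algebraMap 1
  simpa using this

theorem op_ι (X : L) : D.op (ExteriorAlgebra.ι C X) = ExteriorAlgebra.ι C (D.vec X) := by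
  have := D.op_ι_mul X 1
  simpa [D.op_one] using this

/-- `vec` is a bare function in the structure. Its algebraic properties are inherited from `op`
through the injectivity of `ι`. -/
theorem vec_add (X Y : L) : D.vec (X + Y) = D.vec X + D.vec Y := by
  apply ExteriorAlgebra.ι_leftInverse (R := C) |>.injective
  simp only [map_add, ← op_ι]

theorem vec_smul (f : C) (X : L) : D.vec (f • X) = D.fn f • X + f • D.vec X := by
  apply ExteriorAlgebra.ι_leftInverse (R := C) |>.injective
  -- With the scalar as a right factor, `op_ι_mul` and `op_algebraMap` together give the Leibniz
  -- rule on `L`.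
  have h : ExteriorAlgebra.ι C (f • X) = ExteriorAlgebra.ι C X * algebraMap C _ f := by
    rw [map_smul, Algebra.smul_def, Algebra.commutes]
  rw [← op_ι, h, op_ι_mul, op_algebraMap, map_add, map_smul, map_smul, Algebra.smul_def,
    Algebra.smul_def, Algebra.commutes, Algebra.commutes, add_comm]

theorem op_smul (f : C) (P : ExteriorAlgebra C L) :
    D.op (f • P) = D.fn f • P + f • D.op P := by
  induction P using CliffordAlgebra.left_induction with
  | algebraMap r =>
    change D.op (f • algebraMap C (ExteriorAlgebra C L) r) =
      D.fn f • algebraMap C (ExteriorAlgebra C L) r + f • D.op (algebraMap C _ r)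
    rw [op_algebraMap, Algebra.smul_def, ← map_mul, op_algebraMap, D.fn.leibniz]
    simp only [Algebra.smul_def, Algebra.algebraMap_self, RingHom.id_apply, map_add, map_mul]
    rw [add_comm, Algebra.commutes r]
  | add x y hx hy => rw [smul_add, map_add, hx, hy, map_add, smul_add, smul_add]; abel
  | ι_mul x m hx =>
    change D.op (f • (ExteriorAlgebra.ι C m * x)) = D.fn f • (ExteriorAlgebra.ι C m * x) +
      f • D.op (ExteriorAlgebra.ι C m * x)
    rw [← mul_smul_comm, op_ι_mul, hx, op_ι_mul]
    simp only [mul_add, smul_add, mul_smul_comm]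
    abel

/-- The dual action of a derivation on linear forms. -/
def dual : Module.Dual C L →+ Module.Dual C L where
  toFun β :=
    { toFun := fun X => D.fn (β X) - β (D.vec X)
      map_add' := fun X Y => by simp only [D.vec_add, map_add]; abel
      map_smul' := fun f X => by
        simp only [D.vec_smul, map_add, map_smul, smul_eq_mul, D.fn.leibniz, RingHom.id_apply]
        ring }
  map_zero' := by ext X; simp
  map_add' α β := by
    ext X
    simp only [LinearMap.coe_mk, AddHom.coe_mk, LinearMap.add_apply, map_add]
    abel

theorem dual_apply (β : Module.Dual C L) (X : L) :
    D.dual β X = D.fn (β X) - β (D.vec X) := rfl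

theorem dual_smul (f : C) (β : Module.Dual C L) :
    D.dual (f • β) = D.fn f • β + f • D.dual β := by
  ext X
  simp only [dual_apply, LinearMap.smul_apply, LinearMap.add_apply, smul_eq_mul, D.fn.leibniz]
  ring

theorem dual_real_smul (r : ℝ) (β : Module.Dual C L) : D.dual (r • β) = r • D.dual β := by
  have h := D.dual_smul (algebraMap ℝ C r) β
  rwa [algebraMap_smul, algebraMap_smul, Derivation.map_algebraMap, zero_smul, zero_add] at h

/-- Cartan's formula `[D, ι_β] = ι_{Dβ}`: the commutator is again an odd derivation that kills
functions, so its values on `L` decide. Both the bracket on `L*` and all of its identities are read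
off from it. -/
theorem op_mul_contr (β : Module.Dual C L) :
    D.op * contr β - contr β * D.op = contr (D.dual β) := by
  ext P
  change D.op (contr β P) - contr β (D.op P) = contr (D.dual β) P
  induction P using CliffordAlgebra.left_induction with
  | algebraMap r =>
    change D.op (contr β (algebraMap C (ExteriorAlgebra C L) r)) -
      contr β (D.op (algebraMap C (ExteriorAlgebra C L) r)) =
        contr (D.dual β) (algebraMap C (ExteriorAlgebra C L) r)
    simp only [op_algebraMap, contr_algebraMap, map_zero, sub_zero]
  | add x y hx hy => simp only [map_add, ← hx, ← hy]; abel
  | ι_mul x m hx =>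
    change D.op (contr β (ExteriorAlgebra.ι C m * x)) -
      contr β (D.op (ExteriorAlgebra.ι C m * x)) = contr (D.dual β) (ExteriorAlgebra.ι C m * x)
    simp only [contr_ι_mul, op_ι_mul, map_sub, map_add, ← hx, op_smul, dual_apply, sub_smul,
      mul_sub]
    abel

variable {D D'} in
/-- A derivation is determined by its values on `C` and `L`. -/
theorem op_ext (hfn : ∀ f, D.fn f = D'.fn f) (hvec : ∀ X, D.vec X = D'.vec X) : D.op = D'.op := by
  ext P
  induction P using CliffordAlgebra.left_induction with
  | algebraMap r =>
    change D.op (algebraMap C (ExteriorAlgebra C L) r) = D'.op (algebraMap C _ r)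
    rw [op_algebraMap, op_algebraMap, hfn]
  | add x y hx hy => rw [map_add, map_add, hx, hy]
  | ι_mul x m hx =>
    change D.op (ExteriorAlgebra.ι C m * x) = D'.op (ExteriorAlgebra.ι C m * x)
    rw [op_ι_mul, op_ι_mul, hx, hvec]

theorem fn_eq_of_op_algebraMap {f g : C}
    (h : D.op (algebraMap C _ f) = algebraMap C (ExteriorAlgebra C L) g) : D.fn f = g := by
  rw [op_algebraMap] at h
  exact ExteriorAlgebra.algebraMap_leftInverse L |>.injective h

/-- The commutator of two derivations of degree zero. -/
def commutator : ZeroDerivation C L where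
  op := D.op * D'.op - D'.op * D.op
  fn := ⁅D.fn, D'.fn⁆
  vec X := D.vec (D'.vec X) - D'.vec (D.vec X)
  op_algebraMap f := by
    change D.op (D'.op (algebraMap C _ f)) - D'.op (D.op (algebraMap C _ f)) = _
    simp only [op_algebraMap, Derivation.commutator_apply, map_sub]
  op_ι_mul X P := by
    change D.op (D'.op (ExteriorAlgebra.ι C X * P)) - D'.op (D.op (ExteriorAlgebra.ι C X * P)) =
      _ + ExteriorAlgebra.ι C X * (D.op (D'.op P) - D'.op (D.op P))
    simp only [op_ι_mul, map_add, map_sub, sub_mul, mul_sub]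
    abel

end ZeroDerivation

/-- The derivation `[X, ·]` of `∧L`. -/
def LieRinehartStr.lieDerivation (S : LieRinehartStr C L) (X : L) : ZeroDerivation C L where
  op := S.lieDer X
  fn := S.anchor X
  vec := S.bracket X
  op_algebraMap := S.lieDer_algebraMap X
  op_ι_mul Y P := (S.lieDer_ι_mul X Y P).trans (add_comm _ _)

/-- Both sides are derivations of degree zero. They agree on functions because the anchor preserves
brackets, and on `L` by the Jacobi identity. -/
theorem LieRinehartStr.lieDer_bracket (S : LieRinehartStr C L) (X Y : L)
    (P : ExteriorAlgebra C L) :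
    S.lieDer (S.bracket X Y) P = S.lieDer X (S.lieDer Y P) - S.lieDer Y (S.lieDer X P) := by
  refine DFunLike.congr_fun (ZeroDerivation.op_ext (D := S.lieDerivation (S.bracket X Y))
    (D' := (S.lieDerivation X).commutator (S.lieDerivation Y)) (fun f => ?_) fun Z => ?_) P
  · exact S.anchor_bracket X Y f
  · exact eq_sub_of_add_eq (S.jacobi X Y Z).symm

/-! ## The Lie-Rinehart structure on the dual module -/

namespace IsDegreeOneDerivation

variable {d : ExteriorAlgebra C L → ExteriorAlgebra C L} (hd : IsDegreeOneDerivation d)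

/-- A derivation of degree one as an additive operator. -/
def toEnd : AddMonoid.End (ExteriorAlgebra C L) := AddMonoidHom.mk' d hd.map_add

theorem toEnd_apply (P : ExteriorAlgebra C L) : hd.toEnd P = d P := rfl

theorem toEnd_ι_mul (X : L) (P : ExteriorAlgebra C L) :
    hd.toEnd (ExteriorAlgebra.ι C X * P) =
      hd.toEnd (ExteriorAlgebra.ι C X) * P - ExteriorAlgebra.ι C X * hd.toEnd P := by
  have := hd.leibniz 1 (ExteriorAlgebra.ι C X) P (ι_mem_exteriorPower_one X)
  simpa [toEnd_apply, sub_eq_add_neg] using this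

theorem toEnd_smul (f : C) (P : ExteriorAlgebra C L) :
    hd.toEnd (f • P) = hd.toEnd (algebraMap C _ f) * P + f • hd.toEnd P := by
  have := hd.leibniz 0 (algebraMap C _ f) P (algebraMap_mem_exteriorPower_zero f)
  simpa [toEnd_apply, Algebra.smul_def] using this

theorem toEnd_algebraMap_mul (f g : C) :
    hd.toEnd (algebraMap C _ (f * g)) =
      f • hd.toEnd (algebraMap C _ g) + g • hd.toEnd (algebraMap C _ f) := by
  have := hd.toEnd_smul f (algebraMap C _ g)
  rw [← Algebra.commutes, ← Algebra.smul_def, Algebra.smul_def f, ← map_mul] at this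
  rw [this, add_comm]

theorem toEnd_algebraMap_mem (f : C) : hd.toEnd (algebraMap C _ f) ∈ ⋀[C]^1 L :=
  hd.degree 0 _ (algebraMap_mem_exteriorPower_zero f)

theorem toEnd_ι_mem (X : L) : hd.toEnd (ExteriorAlgebra.ι C X) ∈ ⋀[C]^2 L :=
  hd.degree 1 _ (ι_mem_exteriorPower_one X)

/-- `df` has degree one, so its contraction is already a function and `algebraMapInv` loses nothing.
-/
theorem algebraMap_contr_toEnd_algebraMap (α : Module.Dual C L) (f : C) :
    algebraMap C (ExteriorAlgebra C L)
      (ExteriorAlgebra.algebraMapInv (contr α (hd.toEnd (algebraMap C _ f)))) =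
      contr α (hd.toEnd (algebraMap C _ f)) := by
  obtain ⟨X, hX⟩ := mem_exteriorPower_one.1 (hd.toEnd_algebraMap_mem f)
  rw [← hX, contr_ι, ExteriorAlgebra.algebraMap_leftInverse L]

/-- The derivation `f ↦ (d f)(α)` of `C`. -/
def anchor (α : Module.Dual C L) : Derivation ℝ C C where
  toFun f := ExteriorAlgebra.algebraMapInv (contr α (hd.toEnd (algebraMap C _ f)))
  map_add' f g := by simp only [_root_.map_add]
  map_smul' r f := by
    have h : hd.toEnd (algebraMap C (ExteriorAlgebra C L) (r • f)) =
        algebraMap ℝ C r • hd.toEnd (algebraMap C _ f) := by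
      rw [algebraMap_smul, toEnd_apply, toEnd_apply, ← hd.map_smul]
      congr 1
      rw [Algebra.smul_def, map_mul, ← Algebra.smul_def, algebraMap_smul]
    rw [h, contr_smul_apply, _root_.map_smul, algebraMap_smul, RingHom.id_apply]
  map_one_eq_zero' := by
    have := hd.toEnd_algebraMap_mul 1 1
    rw [mul_one, one_smul, left_eq_add] at this
    simp only [LinearMap.coe_mk, AddHom.coe_mk, this, map_zero]
  leibniz' f g := by
    simp only [LinearMap.coe_mk, AddHom.coe_mk, toEnd_algebraMap_mul, _root_.map_add, contr_smul_apply,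
      _root_.map_smul]

theorem algebraMap_anchor (α : Module.Dual C L) (f : C) :
    algebraMap C _ (hd.anchor α f) = contr α (hd.toEnd (algebraMap C _ f)) :=
  hd.algebraMap_contr_toEnd_algebraMap α f

/-- Both summands have degree one: contraction lowers `dX` from degree two, and `d` raises the
function `α(X)`. The witness is the Lie derivative of `X`. -/
theorem exists_ι_eq (α : Module.Dual C L) (X : L) : ∃ Y, ExteriorAlgebra.ι C Y =
    contr α (hd.toEnd (ExteriorAlgebra.ι C X)) + hd.toEnd (contr α (ExteriorAlgebra.ι C X)) := by
  refine mem_exteriorPower_one.1 (Submodule.add_mem _ ?_ ?_)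
  · exact contr_mem_of_mem_two α (hd.toEnd_ι_mem X)
  · rw [contr_ι]
    exact hd.toEnd_algebraMap_mem _

/-- The Lie derivative `ι_α d + d ι_α`. -/
def lie (α : Module.Dual C L) : ZeroDerivation C L where
  op := contr α * hd.toEnd + hd.toEnd * contr α
  fn := hd.anchor α
  vec X := (hd.exists_ι_eq α X).choose
  op_algebraMap f := by
    rw [algebraMap_anchor]
    change contr α (hd.toEnd _) + hd.toEnd (contr α _) = _
    rw [contr_algebraMap, map_zero, add_zero]
  op_ι_mul X P := by
    rw [(hd.exists_ι_eq α X).choose_spec]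
    change contr α (hd.toEnd _) + hd.toEnd (contr α _) = _ + _ * (contr α (hd.toEnd P) + hd.toEnd _)
    -- The terms `dX ∧ ι_α P` and `α(X) dP` each occur twice with opposite signs; what survives is
    -- the Leibniz rule.
    rw [toEnd_ι_mul, map_sub, contr_mul_of_mem_two α (hd.toEnd_ι_mem X), contr_ι_mul, contr_ι_mul,
      map_sub, toEnd_smul, toEnd_ι_mul, contr_ι]
    simp only [mul_add, add_mul]
    abel

theorem op_lie (α : Module.Dual C L) :
    (hd.lie α).op = contr α * hd.toEnd + hd.toEnd * contr α := rfl

theorem lie_fn (α : Module.Dual C L) : (hd.lie α).fn = hd.anchor α := rfl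

theorem ι_lie_vec (α : Module.Dual C L) (X : L) : ExteriorAlgebra.ι C ((hd.lie α).vec X) =
    contr α (hd.toEnd (ExteriorAlgebra.ι C X)) + hd.toEnd (contr α (ExteriorAlgebra.ι C X)) :=
  (hd.exists_ι_eq α X).choose_spec

theorem algebraMap_apply_lie_vec (α β : Module.Dual C L) (X : L) :
    algebraMap C (ExteriorAlgebra C L) (β ((hd.lie α).vec X)) =
      contr β (contr α (hd.toEnd (ExteriorAlgebra.ι C X))) +
        algebraMap C _ (hd.anchor β (α X)) := by
  rw [← contr_ι, ι_lie_vec, _root_.map_add, contr_ι, algebraMap_anchor]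

theorem apply_lie_vec (α β : Module.Dual C L) (X : L) : β ((hd.lie α).vec X) =
    ExteriorAlgebra.algebraMapInv (contr β (contr α (hd.toEnd (ExteriorAlgebra.ι C X)))) +
      hd.anchor β (α X) := by
  have := congrArg ExteriorAlgebra.algebraMapInv (hd.algebraMap_apply_lie_vec α β X)
  rwa [_root_.map_add, ExteriorAlgebra.algebraMap_leftInverse L, ExteriorAlgebra.algebraMap_leftInverse L] at this

/-- This identifies the derived bracket with the usual formula for `dX(α, β)`: in `β(L_α X)`, the
part `ι_α d` contributes `dX(α, β)` and the part `d ι_α` contributes the anchor term of `β`. -/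
theorem lie_dual_apply (α β : Module.Dual C L) (X : L) : (hd.lie α).dual β X =
    hd.anchor α (β X) - hd.anchor β (α X) -
      ExteriorAlgebra.algebraMapInv (contr β (contr α (hd.toEnd (ExteriorAlgebra.ι C X)))) := by
  rw [ZeroDerivation.dual_apply, apply_lie_vec, lie_fn]
  abel

theorem lie_dual_self (α : Module.Dual C L) : (hd.lie α).dual α = 0 := by
  ext X
  simp [lie_dual_apply, contr_contr]

theorem anchor_add (α β : Module.Dual C L) : hd.anchor (α + β) = hd.anchor α + hd.anchor β := by
  ext f
  change ExteriorAlgebra.algebraMapInv (contr (α + β) (hd.toEnd (algebraMap C _ f))) =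
    ExteriorAlgebra.algebraMapInv (contr α (hd.toEnd (algebraMap C _ f))) +
      ExteriorAlgebra.algebraMapInv (contr β (hd.toEnd (algebraMap C _ f)))
  rw [contr_add]
  exact _root_.map_add _ _ _

theorem anchor_smul (g : C) (α : Module.Dual C L) : hd.anchor (g • α) = g • hd.anchor α := by
  ext f
  change ExteriorAlgebra.algebraMapInv (contr (g • α) (hd.toEnd (algebraMap C _ f))) =
    g • ExteriorAlgebra.algebraMapInv (contr α (hd.toEnd (algebraMap C _ f)))
  rw [contr_smul, _root_.map_smul]

/-- Contractions anticommute. Besides skew-symmetry, this transfers linearity of the bracket from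
the second argument to the first. -/
theorem lie_dual_swap (α β : Module.Dual C L) : (hd.lie α).dual β = -(hd.lie β).dual α := by
  ext X
  rw [LinearMap.neg_apply, lie_dual_apply, lie_dual_apply, contr_apply, contr_apply,
    CliffordAlgebra.contractLeft_comm, map_neg, contr_apply, contr_apply]
  abel

variable (hsq : ∀ P, d (d P) = 0)
include hsq

theorem toEnd_mul_toEnd : hd.toEnd * hd.toEnd = 0 := by
  ext P
  exact hsq P

/-- Expand `ι_{[α,β]} = [L_α, ι_β]` inside `L_{[α,β]}`; every term containing `d²` drops out. The
Jacobi identity and the compatibility of the anchor with brackets both rest on this. -/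
theorem op_lie_dual (α β : Module.Dual C L) :
    (hd.lie ((hd.lie α).dual β)).op =
      (hd.lie α).op * (hd.lie β).op - (hd.lie β).op * (hd.lie α).op := by
  rw [op_lie, ← ZeroDerivation.op_mul_contr, op_lie, op_lie]
  have h := toEnd_mul_toEnd hd hsq
  generalize hd.toEnd = δ at h
  have h' (x : AddMonoid.End (ExteriorAlgebra C L)) : δ * (δ * x) = 0 := by
    rw [← mul_assoc, h, zero_mul]
  simp only [mul_add, add_mul, sub_mul, mul_sub, mul_assoc, h, h', mul_zero]
  abel

/-- The Lie-Rinehart structure on `L*` defined by a differential on `∧L`. -/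
def dualLieRinehart : LieRinehartStr C (Module.Dual C L) where
  bracket := LinearMap.mk₂ ℝ (fun α β => (hd.lie α).dual β)
    (fun α α' β => by
      rw [lie_dual_swap, _root_.map_add, neg_add, lie_dual_swap hd α, lie_dual_swap hd α'])
    (fun r α β => by rw [lie_dual_swap, ZeroDerivation.dual_real_smul, lie_dual_swap hd β, _root_.smul_neg,
      _root_.neg_neg])
    (fun α β β' => _root_.map_add _ _ _) (fun r α β => (hd.lie α).dual_real_smul r β)
  anchor :=
    { toFun := hd.anchor
      map_add' := hd.anchor_add
      map_smul' := hd.anchor_smul }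
  bracket_self := hd.lie_dual_self
  jacobi α β γ := by
    -- As operators, `ι_{[α,[β,γ]]} = [L_α, [L_β, ι_γ]]`, so with `op_lie_dual` this is the Jacobi
    -- identity for commutators.
    apply contr_injective
    change contr ((hd.lie α).dual ((hd.lie β).dual γ)) =
      contr ((hd.lie ((hd.lie α).dual β)).dual γ + (hd.lie β).dual ((hd.lie α).dual γ))
    rw [contr_add]
    simp only [← ZeroDerivation.op_mul_contr, op_lie_dual hd hsq, mul_sub, sub_mul, mul_assoc]
    abel
  leibniz α f β := ((hd.lie α).dual_smul f β).trans (add_comm _ _)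
  anchor_bracket α β f := by
    refine (hd.lie ((hd.lie α).dual β)).fn_eq_of_op_algebraMap ?_
    rw [op_lie_dual hd hsq]
    exact ((hd.lie α).commutator (hd.lie β)).op_algebraMap f

omit hsq

section Invariance

variable (D : ZeroDerivation C L) (hD : D.op * hd.toEnd = hd.toEnd * D.op)
include hD

/-- The commutator with `D` passes through `d` and acts on `ι_α` alone, where it gives `ι_{Dα}`. -/
theorem op_lie_dual_of_commute (α : Module.Dual C L) :
    (hd.lie (D.dual α)).op = D.op * (hd.lie α).op - (hd.lie α).op * D.op := by
  rw [op_lie, ← ZeroDerivation.op_mul_contr, op_lie]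
  simp only [mul_add, add_mul, sub_mul, mul_sub]
  have hD' (x : AddMonoid.End (ExteriorAlgebra C L)) :
      D.op * (hd.toEnd * x) = hd.toEnd * (D.op * x) := by rw [← mul_assoc, hD, mul_assoc]
  simp only [mul_assoc, hD, hD']
  abel

/-- Again the Jacobi identity for commutators, now of `D`, `L_α` and `ι_β`. -/
theorem dual_lie_dual (α β : Module.Dual C L) : D.dual ((hd.lie α).dual β) =
    (hd.lie (D.dual α)).dual β + (hd.lie α).dual (D.dual β) := by
  apply contr_injective
  rw [contr_add]
  simp only [← ZeroDerivation.op_mul_contr, op_lie_dual_of_commute hd D hD, mul_sub, sub_mul,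
    mul_assoc]
  abel

theorem anchor_dual (α : Module.Dual C L) (f : C) :
    hd.anchor (D.dual α) f = D.fn (hd.anchor α f) - hd.anchor α (D.fn f) := by
  refine (hd.lie (D.dual α)).fn_eq_of_op_algebraMap ?_
  rw [op_lie_dual_of_commute hd D hD]
  exact (D.commutator (hd.lie α)).op_algebraMap f

end Invariance

end IsDegreeOneDerivation

end DualLieRinehart

end

section

/-! ## Contractions with dual bases of a quadratic Lie algebra -/

section DualPair

variable {𝔤 : Type*} [LieRing 𝔤] [LieAlgebra ℝ 𝔤]

/-- Two finite families `e_i` and `e^i` which are dual bases with respect to `B`. -/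
structure IsDualPair {ι : Type*} [Fintype ι] (B : LinearMap.BilinForm ℝ 𝔤) (e e' : ι → 𝔤) :
    Prop where
  left : ∀ x, ∑ i, B (e' i) x • e i = x
  right : ∀ x, ∑ i, B (e i) x • e' i = x

theorem IsDualPair.symm {ι : Type*} [Fintype ι] {B : LinearMap.BilinForm ℝ 𝔤} {e e' : ι → 𝔤}
    (h : IsDualPair B e e') : IsDualPair B e' e := ⟨h.right, h.left⟩

theorem isDualPair_dualBasis [FiniteDimensional ℝ 𝔤] {B : LinearMap.BilinForm ℝ 𝔤}
    (hB_symm : B.IsSymm) (hB : B.Nondegenerate) {ι : Type*} [Fintype ι] [DecidableEq ι]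
    (e : Module.Basis ι ℝ 𝔤) : IsDualPair B e (B.dualBasis hB e) where
  left x := by
    refine e.ext_elem fun j => ?_
    have : x = ∑ i, e.repr x i • e i := (e.sum_repr x).symm
    rw [e.repr_sum_self]
    conv_lhs => rw [this, map_sum]
    simp [LinearMap.BilinForm.apply_dualBasis_left]
  right x := by
    conv_rhs => rw [← (B.dualBasis hB e).sum_repr x]
    simp only [LinearMap.BilinForm.dualBasis_repr_apply, hB_symm.eq]

variable {W : Type*} [AddCommGroup W] [Module ℝ W]
  {ι κ : Type*} [Fintype ι] [Fintype κ] {B : LinearMap.BilinForm ℝ 𝔤} (hB_symm : B.IsSymm)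
  {e e' : ι → 𝔤} {f f' : κ → 𝔤}
include hB_symm

/-- The tensor `∑ e^i ⊗ e_i` does not depend on the dual bases: expand `e^i` in the second family
and resum over the first. -/
theorem IsDualPair.sum_eq (he : IsDualPair B e e') (hf : IsDualPair B f f')
    (b : 𝔤 →ₗ[ℝ] 𝔤 →ₗ[ℝ] W) : ∑ i, b (e' i) (e i) = ∑ j, b (f' j) (f j) := by
  calc ∑ i, b (e' i) (e i) = ∑ i, ∑ j, B (e' i) (f j) • b (f' j) (e i) := by
        refine Finset.sum_congr rfl fun i _ => ?_
        conv_lhs => rw [← hf.right (e' i)]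
        simp [LinearMap.sum_apply, hB_symm.eq (e' i)]
    _ = ∑ j, b (f' j) (f j) := by
        rw [Finset.sum_comm]
        refine Finset.sum_congr rfl fun j _ => ?_
        conv_rhs => rw [← he.left (f j)]
        simp

theorem IsDualPair.sum_swap (he : IsDualPair B e e') (b : 𝔤 →ₗ[ℝ] 𝔤 →ₗ[ℝ] W) :
    ∑ i, b (e' i) (e i) = ∑ i, b (e i) (e' i) :=
  he.sum_eq hB_symm he.symm b

/-- The tensor `∑ e^i ⊗ e_i` is `𝔤`-invariant, since by invariance of `B` the matrices of `ad ξ` in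
the two bases are negative transposes of each other. -/
theorem IsDualPair.sum_lie (he : IsDualPair B e e') (hB_inv : ∀ ξ η ζ, B ⁅ξ, η⁆ ζ = B ξ ⁅η, ζ⁆)
    (b : 𝔤 →ₗ[ℝ] 𝔤 →ₗ[ℝ] W) (ξ : 𝔤) :
    ∑ i, b ⁅ξ, e' i⁆ (e i) = -∑ i, b (e' i) ⁅ξ, e i⁆ := by
  have h1 : ∑ i, b ⁅ξ, e' i⁆ (e i) = ∑ i, ∑ j, B (e j) ⁅ξ, e' i⁆ • b (e' j) (e i) := by
    refine Finset.sum_congr rfl fun i _ => ?_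
    conv_lhs => rw [← he.right ⁅ξ, e' i⁆]
    simp [LinearMap.sum_apply]
  have h2 : ∑ j, b (e' j) ⁅ξ, e j⁆ = ∑ j, ∑ i, B (e' i) ⁅ξ, e j⁆ • b (e' j) (e i) := by
    refine Finset.sum_congr rfl fun j _ => ?_
    conv_lhs => rw [← he.left ⁅ξ, e j⁆]
    simp
  rw [h1, h2, Finset.sum_comm, ← Finset.sum_neg_distrib]
  refine Finset.sum_congr rfl fun j _ => ?_
  rw [← Finset.sum_neg_distrib]
  refine Finset.sum_congr rfl fun i _ => ?_
  rw [← neg_smul, ← hB_inv, ← lie_skew, map_neg, LinearMap.neg_apply, hB_symm.eq]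

end DualPair

/-! ## Derivations of the exterior algebra -/

section ExteriorDerivations

variable {C L : Type*} [CommRing C] [Algebra ℝ C] [AddCommGroup L] [Module ℝ L]
  [Module C L] [IsScalarTower ℝ C L]

theorem ι_mul_ι_swap (X Y : L) : ExteriorAlgebra.ι C X * ExteriorAlgebra.ι C Y =
    -(ExteriorAlgebra.ι C Y * ExteriorAlgebra.ι C X) :=
  eq_neg_of_add_eq_zero_left (ExteriorAlgebra.ι_add_mul_swap X Y)

theorem exteriorPower_induction {p : ℕ} {motive : ExteriorAlgebra C L → Prop}
    (ι_mul : ∀ X, ∀ P ∈ ⋀[C]^p L, motive (ExteriorAlgebra.ι C X * P))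
    (add : ∀ P Q, motive P → motive Q → motive (P + Q)) {P : ExteriorAlgebra C L}
    (hP : P ∈ ⋀[C]^(p + 1) L) : motive P := by
  rw [ExteriorAlgebra.exteriorPower, pow_succ'] at hP
  refine Submodule.mul_induction_on hP ?_ add
  rintro _ ⟨X, rfl⟩ P hP
  exact ι_mul X P hP

theorem mem_exteriorPower_zero {P : ExteriorAlgebra C L} :
    P ∈ ⋀[C]^0 L ↔ ∃ f, algebraMap C _ f = P := by
  rw [ExteriorAlgebra.exteriorPower, pow_zero, Submodule.mem_one]

theorem ι_mul_mem_exteriorPower (X : L) {p : ℕ} {P : ExteriorAlgebra C L} (hP : P ∈ ⋀[C]^p L) :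
    ExteriorAlgebra.ι C X * P ∈ ⋀[C]^(p + 1) L := by
  rw [ExteriorAlgebra.exteriorPower, pow_succ']
  exact Submodule.mul_mem_mul (LinearMap.mem_range_self _ X) hP

theorem mul_ι_of_mem_exteriorPower (X : L) {p : ℕ} {P : ExteriorAlgebra C L}
    (hP : P ∈ ⋀[C]^p L) :
    ExteriorAlgebra.ι C X * P = (-1) ^ p * (P * ExteriorAlgebra.ι C X) := by
  induction p generalizing P with
  | zero =>
    obtain ⟨f, rfl⟩ := mem_exteriorPower_zero.1 hP
    rw [pow_zero, one_mul, Algebra.commutes]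
  | succ p ih =>
    refine exteriorPower_induction (motive := fun P =>
      ExteriorAlgebra.ι C X * P = (-1) ^ (p + 1) * (P * ExteriorAlgebra.ι C X))
      (fun Y Q hQ => ?_) (fun Q R hQ hR => ?_) hP
    · rw [← mul_assoc, ι_mul_ι_swap, neg_mul, mul_assoc, ih hQ, pow_succ, mul_neg_one, neg_mul,
        ← mul_assoc, ((Commute.neg_one_right (ExteriorAlgebra.ι C Y)).pow_right p).eq]
      simp only [mul_assoc]
    · rw [mul_add, hQ, hR, add_mul, mul_add]

namespace ZeroDerivation

variable (D : ZeroDerivation C L)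

theorem op_mul (P Q : ExteriorAlgebra C L) : D.op (P * Q) = D.op P * Q + P * D.op Q := by
  induction P using CliffordAlgebra.left_induction with
  | algebraMap r =>
    change D.op (algebraMap C (ExteriorAlgebra C L) r * Q) =
      D.op (algebraMap C (ExteriorAlgebra C L) r) * Q + algebraMap C (ExteriorAlgebra C L) r * D.op Q
    rw [← Algebra.smul_def, ← Algebra.smul_def, op_smul, op_algebraMap, ← Algebra.smul_def]
  | add x y hx hy => rw [add_mul, map_add, hx, hy, map_add, add_mul, add_mul]; abel
  | ι_mul x m hx =>
    change D.op (ExteriorAlgebra.ι C m * x * Q) =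
      D.op (ExteriorAlgebra.ι C m * x) * Q + ExteriorAlgebra.ι C m * x * D.op Q
    rw [mul_assoc, op_ι_mul, hx, op_ι_mul]
    simp only [mul_add, add_mul, mul_assoc]
    abel

theorem op_mem_exteriorPower {p : ℕ} {P : ExteriorAlgebra C L} (hP : P ∈ ⋀[C]^p L) :
    D.op P ∈ ⋀[C]^p L := by
  induction p generalizing P with
  | zero =>
    obtain ⟨f, rfl⟩ := mem_exteriorPower_zero.1 hP
    rw [op_algebraMap]
    exact algebraMap_mem_exteriorPower_zero _
  | succ p ih =>
    refine exteriorPower_induction (motive := fun P => D.op P ∈ ⋀[C]^(p + 1) L)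
      (fun Y Q hQ => ?_) (fun Q R hQ hR => ?_) hP
    · rw [op_ι_mul]
      exact Submodule.add_mem _ (ι_mul_mem_exteriorPower _ hQ) (ι_mul_mem_exteriorPower _ (ih hQ))
    · rw [map_add]
      exact Submodule.add_mem _ hQ hR

end ZeroDerivation

namespace LieRinehartStr

variable (S : LieRinehartStr C L)

theorem lieDer_mul (X : L) (P Q : ExteriorAlgebra C L) :
    S.lieDer X (P * Q) = S.lieDer X P * Q + P * S.lieDer X Q :=
  (S.lieDerivation X).op_mul P Q

theorem lieDer_ι (X Y : L) :
    S.lieDer X (ExteriorAlgebra.ι C Y) = ExteriorAlgebra.ι C (S.bracket X Y) :=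
  (S.lieDerivation X).op_ι Y

theorem lieDer_mem_exteriorPower (X : L) {p : ℕ} {P : ExteriorAlgebra C L} (hP : P ∈ ⋀[C]^p L) :
    S.lieDer X P ∈ ⋀[C]^p L :=
  (S.lieDerivation X).op_mem_exteriorPower hP

theorem lieDer_apply_real_smul (X : L) (r : ℝ) (P : ExteriorAlgebra C L) :
    S.lieDer X (r • P) = r • S.lieDer X P := by
  have h := (S.lieDerivation X).op_smul (algebraMap ℝ C r) P
  rw [Derivation.map_algebraMap, zero_smul, zero_add, algebraMap_smul, algebraMap_smul] at h
  exact h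

theorem lieDer_real_smul (r : ℝ) (X : L) (P : ExteriorAlgebra C L) :
    S.lieDer (r • X) P = r • S.lieDer X P := by
  have h := S.lieDer_smul (algebraMap ℝ C r) X P
  rwa [Derivation.map_algebraMap, mul_zero, add_zero, algebraMap_smul, algebraMap_smul] at h

theorem schouten_add (P P' Q : ExteriorAlgebra C L) :
    S.schouten (P + P') Q = S.schouten P Q + S.schouten P' Q := by
  unfold schouten
  exact map_add _ _ _

theorem schouten_zero (Q : ExteriorAlgebra C L) : S.schouten 0 Q = 0 := by
  unfold schouten
  exact map_zero _

theorem schouten_sum {ι : Type*} (s : Finset ι) (P : ι → ExteriorAlgebra C L)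
    (Q : ExteriorAlgebra C L) : S.schouten (∑ i ∈ s, P i) Q = ∑ i ∈ s, S.schouten (P i) Q := by
  unfold schouten
  exact map_sum _ _ _

theorem schouten_real_smul (r : ℝ) (P Q : ExteriorAlgebra C L) :
    S.schouten (r • P) Q = r • S.schouten P Q := by
  induction P using CliffordAlgebra.left_induction with
  | algebraMap f =>
    change S.schouten (r • algebraMap C (ExteriorAlgebra C L) f) Q =
      r • S.schouten (algebraMap C (ExteriorAlgebra C L) f) Q
    have h : r • algebraMap C (ExteriorAlgebra C L) f = algebraMap C _ (r • f) := by
      rw [Algebra.smul_def r f, map_mul, ← Algebra.smul_def, algebraMap_smul]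
    rw [h, schouten_algebraMap, schouten_algebraMap]
    exact (S.adFun Q).map_smul r f
  | add x y hx hy => rw [smul_add, schouten_add, hx, hy, schouten_add, smul_add]
  | ι_mul x m hx =>
    change S.schouten (r • (ExteriorAlgebra.ι C m * x)) Q =
      r • S.schouten (ExteriorAlgebra.ι C m * x) Q
    have h : CliffordAlgebra.involute (r • x) = r • CliffordAlgebra.involute x := by
      rw [← algebraMap_smul C r x, map_smul, algebraMap_smul]
    rw [← mul_smul_comm, schouten_ι_mul, hx, schouten_ι_mul, h, smul_add, mul_smul_comm,
      smul_mul_assoc]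

theorem schouten_ι_mul_ι_mul_ι (X Y Z : L) (P : ExteriorAlgebra C L) :
    S.schouten (ExteriorAlgebra.ι C X * ExteriorAlgebra.ι C Y * ExteriorAlgebra.ι C Z) P =
      ExteriorAlgebra.ι C X * ExteriorAlgebra.ι C Y * S.lieDer Z P -
        ExteriorAlgebra.ι C X * ExteriorAlgebra.ι C Z * S.lieDer Y P +
        ExteriorAlgebra.ι C Y * ExteriorAlgebra.ι C Z * S.lieDer X P := by
  have h (W : L) : CliffordAlgebra.involute (ExteriorAlgebra.ι C W) = -ExteriorAlgebra.ι C W :=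
    CliffordAlgebra.involute_ι _
  rw [mul_assoc, schouten_ι_mul, schouten_ι_mul, schouten_ι, map_mul, h, h, neg_mul_neg, mul_add,
    neg_mul, mul_neg, ← mul_assoc, ← mul_assoc, sub_eq_add_neg]

end LieRinehartStr

end ExteriorDerivations

end

section

/-! ## The differential `𝒟 + 1/2 ∑ ρ(e^i) ∧ [ρ(e_i), ·]` -/

section CasimirDifferential

variable {C L : Type*} [CommRing C] [Algebra ℝ C] [AddCommGroup L] [Module ℝ L]
  [Module C L] [IsScalarTower ℝ C L] {𝔤 : Type*} [LieRing 𝔤] [LieAlgebra ℝ 𝔤]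
  {ι κ : Type*} [Fintype ι] [Fintype κ]

variable (C) in
/-- The inclusion `𝔤 → ∧L` that a linear map `ρ : 𝔤 → L` defines. -/
def ιLin (ρ : 𝔤 →ₗ[ℝ] L) : 𝔤 →ₗ[ℝ] ExteriorAlgebra C L :=
  (ExteriorAlgebra.ι C).restrictScalars ℝ ∘ₗ ρ

theorem ιLin_apply (ρ : 𝔤 →ₗ[ℝ] L) (ξ : 𝔤) : ιLin C ρ ξ = ExteriorAlgebra.ι C (ρ ξ) := rfl

namespace LieRinehartStr

variable (S : LieRinehartStr C L) (ρ : 𝔤 →ₗ[ℝ] L)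

/-- The map `ξ ↦ [ρ ξ, P]`. -/
def lieLin (P : ExteriorAlgebra C L) : 𝔤 →ₗ[ℝ] ExteriorAlgebra C L where
  toFun ξ := S.lieDer (ρ ξ) P
  map_add' ξ η := by rw [map_add, lieDer_add]
  map_smul' r ξ := by rw [map_smul, lieDer_real_smul, RingHom.id_apply]

theorem lieLin_apply (P : ExteriorAlgebra C L) (ξ : 𝔤) : S.lieLin ρ P ξ = S.lieDer (ρ ξ) P := rfl

/-- The operator `∑ ρ(e^i) ∧ [ρ(e_i), ·]`. -/
def casimir (e e' : ι → 𝔤) (P : ExteriorAlgebra C L) : ExteriorAlgebra C L :=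
  ∑ i, ExteriorAlgebra.ι C (ρ (e' i)) * S.lieDer (ρ (e i)) P

/-- The operator `∑ ρ(e^i) ∧ ρ(e^j) ∧ [ρ([e_i, e_j]), ·]`. -/
def cubicCasimir (e e' : ι → 𝔤) (P : ExteriorAlgebra C L) : ExteriorAlgebra C L :=
  ∑ i, ∑ j, ExteriorAlgebra.ι C (ρ (e' i)) * (ExteriorAlgebra.ι C (ρ (e' j)) *
    S.lieDer (ρ ⁅e i, e j⁆) P)

variable {S ρ} {B : LinearMap.BilinForm ℝ 𝔤} {e e' : ι → 𝔤} {f f' : κ → 𝔤}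

theorem casimir_add (P Q : ExteriorAlgebra C L) :
    S.casimir ρ e e' (P + Q) = S.casimir ρ e e' P + S.casimir ρ e e' Q := by
  simp only [casimir, map_add, mul_add, Finset.sum_add_distrib]

theorem casimir_smul (r : ℝ) (P : ExteriorAlgebra C L) :
    S.casimir ρ e e' (r • P) = r • S.casimir ρ e e' P := by
  simp only [casimir, lieDer_apply_real_smul, mul_smul_comm, Finset.smul_sum]

theorem casimir_mem_exteriorPower {p : ℕ} {P : ExteriorAlgebra C L} (hP : P ∈ ⋀[C]^p L) :
    S.casimir ρ e e' P ∈ ⋀[C]^(p + 1) L :=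
  Submodule.sum_mem _ fun _ _ => ι_mul_mem_exteriorPower _ (S.lieDer_mem_exteriorPower _ hP)

/-- Each `[ρ(e_i), ·]` is an even derivation; the sign comes from moving `ρ(e^i)` past `P`. -/
theorem casimir_mul {p : ℕ} {P : ExteriorAlgebra C L} (hP : P ∈ ⋀[C]^p L)
    (Q : ExteriorAlgebra C L) : S.casimir ρ e e' (P * Q) =
      S.casimir ρ e e' P * Q + (-1) ^ p * (P * S.casimir ρ e e' Q) := by
  simp only [casimir, lieDer_mul, mul_add, Finset.sum_add_distrib, Finset.sum_mul, Finset.mul_sum]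
  simp only [← mul_assoc, mul_ι_of_mem_exteriorPower _ hP]

variable (hB_symm : B.IsSymm)
include hB_symm

theorem casimir_eq (he : IsDualPair B e e') (hf : IsDualPair B f f') (P : ExteriorAlgebra C L) :
    S.casimir ρ e e' P = S.casimir ρ f f' P :=
  he.sum_eq hB_symm hf ((LinearMap.mul ℝ (ExteriorAlgebra C L)).compl₁₂ (ιLin C ρ) (S.lieLin ρ P))

/-- In the cubic Casimir operator, the roles of the two dual bases may be exchanged. -/
theorem cubicCasimir_swap (he : IsDualPair B e e') (P : ExteriorAlgebra C L) :
    S.cubicCasimir ρ e e' P = S.cubicCasimir ρ e' e P := by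
  -- The bases are exchanged one index at a time: with the other index fixed, the summand is
  -- bilinear in `e^i` and `e_i`, so `sum_swap` applies.
  have h1 (j : ι) : ∑ i, ExteriorAlgebra.ι C (ρ (e' i)) * (ExteriorAlgebra.ι C (ρ (e' j)) *
        S.lieDer (ρ ⁅e i, e j⁆) P) =
      ∑ i, ExteriorAlgebra.ι C (ρ (e i)) * (ExteriorAlgebra.ι C (ρ (e' j)) *
        S.lieDer (ρ ⁅e' i, e j⁆) P) := by
    have := he.sum_swap hB_symm ((LinearMap.mul ℝ (ExteriorAlgebra C L)).compl₁₂ (ιLin C ρ)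
      (LinearMap.mulLeft ℝ (ιLin C ρ (e' j)) ∘ₗ S.lieLin ρ P ∘ₗ
        ((LieAlgebra.ad ℝ 𝔤 : 𝔤 →ₗ[ℝ] Module.End ℝ 𝔤).flip (e j))))
    exact this
  have h2 (i : ι) : ∑ j, ExteriorAlgebra.ι C (ρ (e i)) * (ExteriorAlgebra.ι C (ρ (e' j)) *
        S.lieDer (ρ ⁅e' i, e j⁆) P) =
      ∑ j, ExteriorAlgebra.ι C (ρ (e i)) * (ExteriorAlgebra.ι C (ρ (e j)) *
        S.lieDer (ρ ⁅e' i, e' j⁆) P) := by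
    have := he.sum_swap hB_symm ((LinearMap.mul ℝ (ExteriorAlgebra C L)).compl₁₂
      (LinearMap.mulLeft ℝ (ιLin C ρ (e i)) ∘ₗ ιLin C ρ)
      (S.lieLin ρ P ∘ₗ LieAlgebra.ad ℝ 𝔤 (e' i)))
    simpa [ιLin_apply, lieLin_apply, mul_assoc] using this
  unfold cubicCasimir
  rw [Finset.sum_comm, Finset.sum_congr rfl fun j _ => h1 j, Finset.sum_comm,
    Finset.sum_congr rfl fun i _ => h2 i]

variable (hB_inv : ∀ ξ η ζ : 𝔤, B ⁅ξ, η⁆ ζ = B ξ ⁅η, ζ⁆)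
include hB_inv

/-- The Schouten bracket with the image of the Cartan trivector is a multiple of the cubic Casimir
operator. -/
theorem schouten_cartan (he : IsDualPair B e e') (P : ExteriorAlgebra C L) :
    S.schouten (∑ i, ∑ j, ∑ k, B (e' i) ⁅e' j, e' k⁆ • (ExteriorAlgebra.ι C (ρ (e i)) *
      ExteriorAlgebra.ι C (ρ (e j)) * ExteriorAlgebra.ι C (ρ (e k)))) P =
      (3 : ℝ) • S.cubicCasimir ρ e e' P := by
  -- The form `⟨a, [b, c]⟩` is skew in its last two arguments and cyclically invariant, which allows
  -- any relabelling of indices below.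
  have hc1 (a b c : 𝔤) : B a ⁅b, c⁆ = -B a ⁅c, b⁆ := by rw [← lie_skew, map_neg]
  have hc2 (a b c : 𝔤) : B a ⁅b, c⁆ = B c ⁅a, b⁆ := by rw [← hB_inv, hB_symm.eq]
  -- By cyclicity `∑_k ⟨e^i, [e^j, e^k]⟩ e_k = [e^i, e^j]`. The sum is thus the cubic operator with
  -- the two bases interchanged.
  have hK : ∑ i, ∑ j, ∑ k, B (e' i) ⁅e' j, e' k⁆ • (ExteriorAlgebra.ι C (ρ (e i)) *
      ExteriorAlgebra.ι C (ρ (e j)) * S.lieDer (ρ (e k)) P) = S.cubicCasimir ρ e e' P := by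
    rw [cubicCasimir_swap hB_symm he]
    refine Finset.sum_congr rfl fun i _ => Finset.sum_congr rfl fun j _ => ?_
    have h : S.lieDer (ρ ⁅e' i, e' j⁆) P =
        ∑ k, B (e' i) ⁅e' j, e' k⁆ • S.lieDer (ρ (e k)) P := by
      change S.lieLin ρ P _ = ∑ k, _ • S.lieLin ρ P (e k)
      conv_lhs => rw [← he.left ⁅e' i, e' j⁆]
      rw [map_sum]
      refine Finset.sum_congr rfl fun k _ => ?_
      rw [map_smul, hc2 (e' i)]
    rw [h, ← mul_assoc, Finset.mul_sum]
    exact Finset.sum_congr rfl fun k _ => (mul_smul_comm _ _ _).symm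
  simp only [schouten_sum, schouten_real_smul, schouten_ι_mul_ι_mul_ι, smul_add, smul_sub,
    Finset.sum_add_distrib, Finset.sum_sub_distrib]
  -- The other two terms of the bracket with a product of three vectors reduce to `hK` by
  -- relabelling. With its sign, each of the three terms contributes one copy of the cubic operator.
  have h2 : ∑ i, ∑ j, ∑ k, B (e' i) ⁅e' j, e' k⁆ • (ExteriorAlgebra.ι C (ρ (e i)) *
      ExteriorAlgebra.ι C (ρ (e k)) * S.lieDer (ρ (e j)) P) = -S.cubicCasimir ρ e e' P := by
    rw [← hK, ← Finset.sum_neg_distrib]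
    refine Finset.sum_congr rfl fun i _ => ?_
    rw [Finset.sum_comm, ← Finset.sum_neg_distrib]
    refine Finset.sum_congr rfl fun j _ => ?_
    rw [← Finset.sum_neg_distrib]
    refine Finset.sum_congr rfl fun k _ => ?_
    rw [hc1, neg_smul]
  have h3 : ∑ i, ∑ j, ∑ k, B (e' i) ⁅e' j, e' k⁆ • (ExteriorAlgebra.ι C (ρ (e j)) *
      ExteriorAlgebra.ι C (ρ (e k)) * S.lieDer (ρ (e i)) P) = S.cubicCasimir ρ e e' P := by
    rw [← hK, Finset.sum_comm]
    refine Finset.sum_congr rfl fun i _ => ?_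
    rw [Finset.sum_comm]
    refine Finset.sum_congr rfl fun j _ => Finset.sum_congr rfl fun k _ => ?_
    rw [hc2 (e' i)]
  rw [hK, h2, h3]
  module

variable (hρ : ∀ ξ η, ρ ⁅ξ, η⁆ = S.bracket (ρ ξ) (ρ η))
include hρ

/-- By invariance of `∑ e^i ⊗ e_i`, the terms with `[ξ, e^i]` cancel those with `[ξ, e_i]`. -/
theorem lieDer_casimir (he : IsDualPair B e e') (ξ : 𝔤) (P : ExteriorAlgebra C L) :
    S.lieDer (ρ ξ) (S.casimir ρ e e' P) = S.casimir ρ e e' (S.lieDer (ρ ξ) P) := by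
  have h := he.sum_lie hB_symm hB_inv
    ((LinearMap.mul ℝ (ExteriorAlgebra C L)).compl₁₂ (ιLin C ρ) (S.lieLin ρ P)) ξ
  simp only [LinearMap.compl₁₂_apply, LinearMap.mul_apply', ιLin_apply, lieLin_apply] at h
  have h' (i : ι) : S.lieDer (ρ ξ) (S.lieDer (ρ (e i)) P) =
      S.lieDer (ρ ⁅ξ, e i⁆) P + S.lieDer (ρ (e i)) (S.lieDer (ρ ξ) P) := by
    rw [hρ, lieDer_bracket, sub_add_cancel]
  simp only [casimir, map_sum, lieDer_mul, lieDer_ι, ← hρ, Finset.sum_add_distrib, h, h', mul_add]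
  abel

/-- The inner factor `ρ(e^j)` is differentiated or not. Where it is, invariance moves the bracket to
`[e_i, e_j]` and gives `-c`, with `c` the cubic operator. Where it is not, the double derivative is
skew-symmetrized by `ρ(e^i) ∧ ρ(e^j)` and gives `½c`. -/
theorem casimir_casimir (he : IsDualPair B e e') (P : ExteriorAlgebra C L) :
    S.casimir ρ e e' (S.casimir ρ e e' P) = -(1 / 2 : ℝ) • S.cubicCasimir ρ e e' P := by
  have h1 (i : ι) := he.sum_lie hB_symm hB_inv
    ((LinearMap.mul ℝ (ExteriorAlgebra C L)).compl₁₂ (ιLin C ρ) (S.lieLin ρ P)) (e i)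
  simp only [LinearMap.compl₁₂_apply, LinearMap.mul_apply', ιLin_apply, lieLin_apply] at h1
  have h2 : S.cubicCasimir ρ e e' P = (2 : ℝ) • ∑ i, ∑ j, ExteriorAlgebra.ι C (ρ (e' i)) *
      (ExteriorAlgebra.ι C (ρ (e' j)) * S.lieDer (ρ (e i)) (S.lieDer (ρ (e j)) P)) := by
    simp only [cubicCasimir, hρ, lieDer_bracket, mul_sub, Finset.sum_sub_distrib]
    rw [two_smul, sub_eq_add_neg]
    congr 1
    rw [Finset.sum_comm, ← Finset.sum_neg_distrib]
    refine Finset.sum_congr rfl fun i _ => ?_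
    rw [← Finset.sum_neg_distrib]
    refine Finset.sum_congr rfl fun j _ => ?_
    rw [← mul_assoc, ι_mul_ι_swap, neg_mul, neg_neg, mul_assoc]
  have h3 : S.casimir ρ e e' (S.casimir ρ e e' P) = -S.cubicCasimir ρ e e' P +
      ∑ i, ∑ j, ExteriorAlgebra.ι C (ρ (e' i)) *
      (ExteriorAlgebra.ι C (ρ (e' j)) * S.lieDer (ρ (e i)) (S.lieDer (ρ (e j)) P)) := by
    simp only [casimir, map_sum, lieDer_mul, lieDer_ι, ← hρ, Finset.sum_add_distrib, h1, mul_add,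
      mul_neg, Finset.sum_neg_distrib, Finset.mul_sum, cubicCasimir]
  rw [h3, h2]
  module

variable {𝒟 : ExteriorAlgebra C L → ExteriorAlgebra C L} (h𝒟 : S.IsGerstenhaberDerivation 𝒟)
  (h𝒟ρ : ∀ ξ, 𝒟 (ExteriorAlgebra.ι C (ρ ξ)) = 0)
include h𝒟

omit hB_symm hB_inv hρ in
theorem isDegreeOneDerivation_add_casimir :
    IsDegreeOneDerivation fun P => 𝒟 P + (1 / 2 : ℝ) • S.casimir ρ e e' P where
  map_add P Q := by
    rw [h𝒟.map_add, casimir_add, smul_add]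
    abel
  map_smul r P := by rw [h𝒟.map_smul, casimir_smul, smul_add, smul_comm]
  degree p P hP := by
    refine Submodule.add_mem _ (h𝒟.degree p P hP) ?_
    rw [← algebraMap_smul C]
    exact Submodule.smul_mem _ _ (casimir_mem_exteriorPower hP)
  leibniz p P Q hP := by
    rw [h𝒟.leibniz p P Q hP, casimir_mul hP, smul_add, mul_add, mul_add, add_mul, smul_mul_assoc,
      mul_smul_comm, mul_smul_comm]
    abel

include h𝒟ρ

omit hB_symm hB_inv hρ in
-- In the bracket rule for `[ρ(ξ), P]` the term with `𝒟ρ(ξ)` vanishes, and the other carries the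
-- sign `(-1)²`.
theorem lieDer_comm_of_isGerstenhaberDerivation (ξ : 𝔤) (P : ExteriorAlgebra C L) :
    S.lieDer (ρ ξ) (𝒟 P) = 𝒟 (S.lieDer (ρ ξ) P) := by
  have h := h𝒟.bracket 1 (ExteriorAlgebra.ι C (ρ ξ)) P (ι_mem_exteriorPower_one _)
  rw [h𝒟ρ, schouten_zero, schouten_ι, schouten_ι, zero_add] at h
  simpa using h.symm

theorem lieDer_add_casimir (he : IsDualPair B e e') (ξ : 𝔤) (P : ExteriorAlgebra C L) :
    S.lieDer (ρ ξ) (𝒟 P + (1 / 2 : ℝ) • S.casimir ρ e e' P) =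
      𝒟 (S.lieDer (ρ ξ) P) + (1 / 2 : ℝ) • S.casimir ρ e e' (S.lieDer (ρ ξ) P) := by
  rw [map_add, lieDer_comm_of_isGerstenhaberDerivation h𝒟 h𝒟ρ, lieDer_apply_real_smul,
    lieDer_casimir hB_symm hB_inv hρ he]

omit hB_symm hB_inv hρ in
-- `𝒟` anticommutes with multiplication by `ρ(e^i)`, which it kills, and commutes with `[ρ(e_i),
-- ·]`.
theorem apply_casimir_of_isGerstenhaberDerivation (P : ExteriorAlgebra C L) :
    𝒟 (S.casimir ρ e e' P) = -S.casimir ρ e e' (𝒟 P) := by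
  have h (X : L) (hX : 𝒟 (ExteriorAlgebra.ι C X) = 0) (Q : ExteriorAlgebra C L) :
      𝒟 (ExteriorAlgebra.ι C X * Q) = -(ExteriorAlgebra.ι C X * 𝒟 Q) := by
    rw [h𝒟.leibniz 1 _ _ (ι_mem_exteriorPower_one X), hX]
    simp
  change h𝒟.toIsDegreeOneDerivation.toEnd _ = _
  simp only [casimir]
  rw [map_sum, ← Finset.sum_neg_distrib]
  refine Finset.sum_congr rfl fun i _ => ?_
  rw [IsDegreeOneDerivation.toEnd_apply, h _ (h𝒟ρ _),
    lieDer_comm_of_isGerstenhaberDerivation h𝒟 h𝒟ρ]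

/-- The square is `𝒟² + ½(𝒟K + K𝒟) + ¼K²`. The middle term vanishes, and the outer ones are `c/8`
and `-c/8`. -/
theorem add_casimir_sq (he : IsDualPair B e e')
    (h𝒟_sq : ∀ P, 𝒟 (𝒟 P) = (1 / 8 : ℝ) • S.cubicCasimir ρ e e' P) (P : ExteriorAlgebra C L) :
    𝒟 (𝒟 P + (1 / 2 : ℝ) • S.casimir ρ e e' P) +
      (1 / 2 : ℝ) • S.casimir ρ e e' (𝒟 P + (1 / 2 : ℝ) • S.casimir ρ e e' P) = 0 := by
  rw [h𝒟.map_add, h𝒟.map_smul, casimir_add, casimir_smul, h𝒟_sq,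
    apply_casimir_of_isGerstenhaberDerivation h𝒟 h𝒟ρ, casimir_casimir hB_symm hB_inv hρ he]
  module

end LieRinehartStr

end CasimirDifferential

end

section

/-! ## Hadamard's lemma -/

section Hadamard

variable {E : Type*} [NormedAddCommGroup E] [NormedSpace ℝ E]

open MeasureTheory in
/-- The integral over `[0, 1]` of a smooth function depends smoothly on parameters. -/
theorem contDiff_intervalIntegral_param {G : Type*} [NormedAddCommGroup G]
    [NormedSpace ℝ G] {g : E → ℝ → G} (hg : ContDiff ℝ ∞ (Function.uncurry g)) :
    ContDiff ℝ ∞ fun y => ∫ t in (0 : ℝ)..1, g y t := by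
  -- The integral is the convolution of the indicator of `(0, 1]` with `s ↦ χ(s) g(y, -s)`,
  -- evaluated at `0`. The bump provides compact support and equals `1` on `[-1, 1]`, where `-t`
  -- lies.
  let χ : ContDiffBump (0 : ℝ) := ⟨1, 2, one_pos, one_lt_two⟩
  let u : ℝ → ℝ := (Set.Ioc (0 : ℝ) 1).indicator 1
  let k : E → ℝ → G := fun y s => χ s • g y (-s)
  have hk : ContDiffOn ℝ ((⊤ : ℕ∞) : WithTop ℕ∞) (Function.uncurry k) (Set.univ ×ˢ Set.univ) := by
    refine ContDiff.contDiffOn ?_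
    have h1 : ContDiff ℝ ∞ fun p : E × ℝ => χ p.2 := χ.contDiff.comp contDiff_snd
    have h2 : ContDiff ℝ ∞ fun p : E × ℝ => g p.1 (-p.2) :=
      hg.comp (contDiff_fst.prodMk contDiff_snd.neg)
    exact h1.smul h2
  have hu : LocallyIntegrable u volume :=
    ((integrable_indicator_iff measurableSet_Ioc).2
      (integrableOn_const (by simp))).locallyIntegrable
  have h := contDiffOn_convolution_right_with_param_comp (ContinuousLinearMap.lsmul ℝ ℝ)
    (v := fun _ : E => (0 : ℝ)) contDiffOn_const isOpen_univ (isCompact_closedBall (0 : ℝ) 2)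
    (fun y s _ hs => by
      have : χ s = 0 := χ.zero_of_le_dist (not_le.1 fun h => hs h).le
      change χ s • g y (-s) = 0
      rw [this, zero_smul]) hu hk
  convert contDiffOn_univ.1 h using 1
  funext y
  rw [intervalIntegral.integral_of_le zero_le_one, ← integral_indicator measurableSet_Ioc]
  refine integral_congr_ae (Filter.Eventually.of_forall fun t => ?_)
  by_cases ht : t ∈ Set.Ioc (0 : ℝ) 1
  · have h1 : χ (-t) = 1 := χ.one_of_mem_closedBall (by
      simpa [abs_of_pos ht.1] using ht.2)
    simp [u, ht, h1]
  · simp [u, ht]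

/-- The fundamental theorem of calculus along the segment from `c` to `y`; `G y` is the average of
the derivative of `f` over that segment. -/
theorem exists_contDiff_eq_add_apply_sub {f : E → ℝ} (hf : ContDiff ℝ ∞ f)
    (c : E) :
    ∃ G : E → E →L[ℝ] ℝ, ContDiff ℝ ∞ G ∧ ∀ y, f y = f c + G y (y - c) := by
  have hf' : ContDiff ℝ ∞ (fderiv ℝ f) := hf.fderiv_right (by simp)
  have hl : ContDiff ℝ ∞ fun p : E × ℝ => c + p.2 • (p.1 - c) := by fun_prop
  refine ⟨fun y => ∫ t in (0 : ℝ)..1, fderiv ℝ f (c + t • (y - c)),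
    contDiff_intervalIntegral_param (hf'.comp hl), fun y => ?_⟩
  have hd (t : ℝ) : HasDerivAt (fun t : ℝ => f (c + t • (y - c)))
      (fderiv ℝ f (c + t • (y - c)) (y - c)) t := by
    have h1 : HasDerivAt (fun t : ℝ => c + t • (y - c)) (y - c) t := by
      simpa using ((hasDerivAt_id t).smul_const (y - c)).const_add c
    exact ((hf.differentiable (by simp)) _).hasFDerivAt.comp_hasDerivAt t h1
  have hc : Continuous fun t : ℝ => fderiv ℝ f (c + t • (y - c)) :=
    hf'.continuous.comp (by fun_prop)
  have h := intervalIntegral.integral_eq_sub_of_hasDerivAt (fun t _ => hd t)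
    ((hc.clm_apply continuous_const).intervalIntegrable 0 1)
  rw [ContinuousLinearMap.intervalIntegral_apply (hc.intervalIntegrable 0 1), h]
  simp

end Hadamard

end

section

/-! ## Sections of vector bundles -/

section BundleMaps

open Bundle Topology

variable {E : Type*} [NormedAddCommGroup E] [NormedSpace ℝ E] [FiniteDimensional ℝ E]
  {M : Type*} [TopologicalSpace M] [T2Space M] [ChartedSpace E M] [IsManifold 𝓘(ℝ, E) ∞ M]

variable (E) in
/-- Smooth cutoff functions. -/
theorem exists_cutoff {x : M} {U : Set M} (hU : U ∈ 𝓝 x) :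
    ∃ χ : C^∞⟮𝓘(ℝ, E), M; ℝ⟯, (∀ᶠ y in 𝓝 x, χ y = 1) ∧ tsupport χ ⊆ U := by
  obtain ⟨χ, -, hχ⟩ := (SmoothBumpFunction.nhds_basis_tsupport (I := 𝓘(ℝ, E)) x).mem_iff.1 hU
  exact ⟨⟨χ, χ.contMDiff⟩, χ.eventuallyEq_one, hχ⟩

/-- The product of a cutoff function and a locally defined function. -/
def cutoffMul (χ : C^∞⟮𝓘(ℝ, E), M; ℝ⟯) (f : M → ℝ)
    (hf : ∀ x ∈ tsupport χ, ContMDiffAt 𝓘(ℝ, E) 𝓘(ℝ, ℝ) ∞ f x) : C^∞⟮𝓘(ℝ, E), M; ℝ⟯ :=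
  ⟨fun x => χ x * f x, contMDiff_of_tsupport fun x hx =>
    χ.contMDiff.contMDiffAt.mul (hf x (tsupport_mul_subset_left hx))⟩

variable {F : Type*} [NormedAddCommGroup F] [NormedSpace ℝ F] [FiniteDimensional ℝ F]
  {V : M → Type*} [TopologicalSpace (Bundle.TotalSpace F V)] [∀ x, TopologicalSpace (V x)]
  [FiberBundle F V] [∀ x, AddCommGroup (V x)] [∀ x, Module ℝ (V x)] [VectorBundle ℝ F V]
  [ContMDiffVectorBundle ∞ F V 𝓘(ℝ, E)]

/-- Evaluation of sections at a point. -/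
def sectionEval (x : M) : Cₛ^∞⟮𝓘(ℝ, E); F, V⟯ →ₗ[ℝ] V x where
  toFun s := s x
  map_add' _ _ := rfl
  map_smul' _ _ := rfl

theorem sectionEval_apply (x : M) (s : Cₛ^∞⟮𝓘(ℝ, E); F, V⟯) : sectionEval x s = s x := rfl

/-- A frame of `V` near `x₀`, multiplied by a cutoff function. -/
def cutoffFrame (x₀ : M) (χ : C^∞⟮𝓘(ℝ, E), M; ℝ⟯)
    (hχ : tsupport χ ⊆ (trivializationAt F V x₀).baseSet) {ι : Type*} (b : Module.Basis ι ℝ F)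
    (i : ι) : Cₛ^∞⟮𝓘(ℝ, E); F, V⟯ :=
  ⟨(χ : M → ℝ) • (trivializationAt F V x₀).localFrame b i,
    χ.contMDiff.contMDiffOn.smul_section_of_tsupport (trivializationAt F V x₀).open_baseSet hχ
      ((trivializationAt F V x₀).contMDiffOn_localFrame_baseSet ∞ b i)⟩

theorem cutoffFrame_apply {x₀ : M} {χ : C^∞⟮𝓘(ℝ, E), M; ℝ⟯}
    {hχ : tsupport χ ⊆ (trivializationAt F V x₀).baseSet} {ι : Type*} {b : Module.Basis ι ℝ F}
    {i : ι} {x : M} (hx : χ x = 1) : cutoffFrame x₀ χ hχ b i x =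
      (trivializationAt F V x₀).symmL ℝ x (b i) := by
  have hx' : x ∈ (trivializationAt F V x₀).baseSet := hχ (subset_tsupport _ (by simp [hx]))
  change χ x • (trivializationAt F V x₀).localFrame b i x = _
  rw [hx, one_smul, Trivialization.localFrame_apply_of_mem_baseSet _ _ hx']
  rw [Trivialization.symmL_apply _ hx']
  simp [Trivialization.basisAt]

/-- Values of a `C^∞(M)`-linear map on sections in terms of a frame. -/
theorem map_section_eq_sum {N : Type*} [AddCommGroup N] [Module C^∞⟮𝓘(ℝ, E), M; ℝ⟯ N]
    (T : Cₛ^∞⟮𝓘(ℝ, E); F, V⟯ →ₗ[C^∞⟮𝓘(ℝ, E), M; ℝ⟯] N) (x₀ : M) (χ : C^∞⟮𝓘(ℝ, E), M; ℝ⟯)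
    (hχ : tsupport χ ⊆ (trivializationAt F V x₀).baseSet) {ι : Type*} [Fintype ι]
    (b : Module.Basis ι ℝ F) (s : Cₛ^∞⟮𝓘(ℝ, E); F, V⟯) :
    ∃ c : ι → C^∞⟮𝓘(ℝ, E), M; ℝ⟯, (∀ i x, χ x = 1 → c i x =
        b.coord i ((trivializationAt F V x₀).continuousLinearMapAt ℝ x (s x))) ∧
      (χ * χ) • T s = ∑ i, c i • T (cutoffFrame x₀ χ hχ b i) := by
  have : ContMDiffVectorBundle 1 F V 𝓘(ℝ, E) := .of_le (n := ∞) (by simp)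
  let e := trivializationAt F V x₀
  have hc (i : ι) (x : M) (hx : x ∈ tsupport χ) : ContMDiffAt 𝓘(ℝ, E) 𝓘(ℝ, ℝ) ∞
      (fun y => e.localFrameCoeff 𝓘(ℝ, E) b i y (s y)) x :=
    contMDiffAt_localFrameCoeff b (hχ hx) s.contMDiff.contMDiffAt i
  refine ⟨fun i => cutoffMul χ _ (hc i), fun i x hx => ?_, ?_⟩
  · have hx' : x ∈ e.baseSet := hχ (subset_tsupport _ (by simp [hx]))
    change χ x * e.localFrameCoeff 𝓘(ℝ, E) b i x (s x) = _
    rw [hx, one_mul, Trivialization.localFrameCoeff_eq_coeff (s := s) e hx',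
      Trivialization.continuousLinearMapAt_apply, Trivialization.linearMapAt_apply, if_pos hx',
      Module.Basis.coord_apply]
  -- One factor `χ` makes the coefficients global, the other the frame, hence `χ²`. Outside the base
  -- set `χ` vanishes.
  · rw [← map_smul]
    simp_rw [← map_smul]
    rw [← map_sum]
    congr 1
    ext x
    rw [← sectionEval_apply, ← sectionEval_apply, map_sum]
    change (χ x * χ x) • s x = ∑ i, (χ x * e.localFrameCoeff 𝓘(ℝ, E) b i x (s x)) •
      (χ x • e.localFrame b i x)
    by_cases hx : x ∈ e.baseSet
    · conv_lhs => rw [e.eq_sum_localFrameCoeff_smul (I := 𝓘(ℝ, E)) (b := b) (s := s) hx]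
      rw [Finset.smul_sum]
      refine Finset.sum_congr rfl fun i _ => ?_
      rw [smul_smul, smul_smul]
      congr 1
      ring
    · have h0 : χ x = 0 := image_eq_zero_of_notMem_tsupport fun h => hx (hχ h)
      simp [h0]

variable (E F) in
theorem exists_section_apply_eq (x : M) (v : V x) : ∃ s : Cₛ^∞⟮𝓘(ℝ, E); F, V⟯, s x = v := by
  let b := Module.finBasis ℝ F
  let e := trivializationAt F V x
  have hx : x ∈ e.baseSet := FiberBundle.mem_baseSet_trivializationAt' x
  obtain ⟨χ, hχ1, hχ⟩ := exists_cutoff E (e.open_baseSet.mem_nhds hx)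
  refine ⟨∑ i, b.repr (e.continuousLinearMapAt ℝ x v) i • cutoffFrame x χ hχ b i, ?_⟩
  rw [← sectionEval_apply, map_sum]
  simp_rw [map_smul, sectionEval_apply, cutoffFrame_apply hχ1.self_of_nhds, ← map_smul]
  rw [← map_sum, b.sum_repr, e.symmL_continuousLinearMapAt hx]

variable {G : Type*} [NormedAddCommGroup G] [NormedSpace ℝ G]
  {W : M → Type*} [TopologicalSpace (Bundle.TotalSpace G W)] [∀ x, TopologicalSpace (W x)]
  [FiberBundle G W] [∀ x, AddCommGroup (W x)] [∀ x, Module ℝ (W x)] [VectorBundle ℝ G W]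
  [∀ x, IsTopologicalAddGroup (W x)] [∀ x, ContinuousSMul ℝ (W x)]

/-- Near `x₀` the columns of the matrix of `φ` are the images of a cutoff frame, and these are
smooth by hypothesis. -/
theorem contMDiff_of_forall_section {φ : ∀ x, V x →L[ℝ] W x}
    (hφ : ∀ s : Cₛ^∞⟮𝓘(ℝ, E); F, V⟯, ContMDiff 𝓘(ℝ, E) (𝓘(ℝ, E).prod 𝓘(ℝ, G)) ∞
      fun x => TotalSpace.mk' G x (φ x (s x))) :
    ContMDiff 𝓘(ℝ, E) (𝓘(ℝ, E).prod 𝓘(ℝ, F →L[ℝ] G)) ∞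
      fun x => TotalSpace.mk' (F →L[ℝ] G) (E := fun x => V x →L[ℝ] W x) x (φ x) := by
  intro x₀
  rw [contMDiffAt_hom_bundle]
  refine ⟨contMDiffAt_id, ?_⟩
  let b := Module.finBasis ℝ F
  obtain ⟨χ, hχ1, hχ⟩ := exists_cutoff E ((trivializationAt F V x₀).open_baseSet.mem_nhds
    (FiberBundle.mem_baseSet_trivializationAt' x₀))
  have h (i) : ContMDiffAt 𝓘(ℝ, E) 𝓘(ℝ, G) ∞ (fun x =>
      (trivializationAt G W x₀ ⟨x, φ x (cutoffFrame x₀ χ hχ b i x)⟩).2) x₀ :=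
    (contMDiffAt_section _).1 (hφ (cutoffFrame x₀ χ hχ b i) x₀)
  have hs : ContMDiffAt 𝓘(ℝ, E) 𝓘(ℝ, F →L[ℝ] G) ∞ (fun x => ∑ i,
      (ContinuousLinearMap.smulRightL ℝ F G (b.coord i).toContinuousLinearMap)
        (trivializationAt G W x₀ ⟨x, φ x (cutoffFrame x₀ χ hχ b i x)⟩).2) x₀ :=
    ContMDiffAt.sum fun i _ => (ContinuousLinearMap.contMDiff _).contMDiffAt.comp x₀ (h i)
  refine hs.congr_of_eventuallyEq ?_
  filter_upwards [hχ1, (trivializationAt G W x₀).open_baseSet.mem_nhds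
    (FiberBundle.mem_baseSet_trivializationAt' x₀)] with x hx hxW
  ext v
  conv_lhs => rw [← b.sum_repr v]
  simp only [map_sum, map_smul, ContinuousLinearMap.inCoordinates, ContinuousLinearMap.comp_apply,
    _root_.sum_apply, cutoffFrame_apply hx]
  refine Finset.sum_congr rfl fun i _ => ?_
  rw [Trivialization.continuousLinearMapAt_apply, Trivialization.linearMapAt_apply, if_pos hxW]
  rfl

/-- A `C^∞(M)`-linear map on sections is induced by a smooth bundle map. -/
theorem exists_bundleMap (T : Cₛ^∞⟮𝓘(ℝ, E); F, V⟯ →ₗ[C^∞⟮𝓘(ℝ, E), M; ℝ⟯] Cₛ^∞⟮𝓘(ℝ, E); G, W⟯) :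
    ∃ φ : Cₛ^∞⟮𝓘(ℝ, E); F →L[ℝ] G, fun x => V x →L[ℝ] W x⟯, ∀ s x, φ x (s x) = T s x := by
  classical
  let b := Module.finBasis ℝ F
  -- Since `χ x = 1`, the frame expansion shows that `T s x` depends only on `s x`, and it supplies
  -- the linear map.
  have hT (x : M) : ∃ φ : V x →L[ℝ] W x, ∀ s, φ (s x) = T s x := by
    obtain ⟨χ, hχ1, hχ⟩ := exists_cutoff E ((trivializationAt F V x).open_baseSet.mem_nhds
      (FiberBundle.mem_baseSet_trivializationAt' x))
    refine ⟨(∑ i, (b.coord i).toContinuousLinearMap.smulRight (T (cutoffFrame x χ hχ b i) x)) ∘L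
      (trivializationAt F V x).continuousLinearMapAt ℝ x, fun s => ?_⟩
    obtain ⟨c, hc, h⟩ := map_section_eq_sum T x χ hχ b s
    have hx := hχ1.self_of_nhds
    have h' := congrArg (fun s : Cₛ^∞⟮𝓘(ℝ, E); G, W⟯ => sectionEval x s) h
    simp only [map_sum] at h'
    change (χ x * χ x) • T s x = ∑ i, c i x • T (cutoffFrame x χ hχ b i) x at h'
    rw [hx, one_mul, one_smul] at h'
    rw [h']
    simp only [ContinuousLinearMap.comp_apply, _root_.sum_apply,
      ContinuousLinearMap.smulRight_apply, hc _ x hx]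
    rfl
  choose φ hφ using hT
  exact ⟨⟨φ, contMDiff_of_forall_section fun s => by simpa only [hφ] using! (T s).contMDiff⟩,
    fun s x => hφ x s⟩

end BundleMaps

end

section

/-! ## Derivations of `C^∞(M)` are vector fields -/

section Derivations

open Bundle Topology

variable {E : Type*} [NormedAddCommGroup E] [NormedSpace ℝ E] [FiniteDimensional ℝ E]
  {M : Type*} [TopologicalSpace M] [T2Space M] [ChartedSpace E M] [IsManifold 𝓘(ℝ, E) ∞ M]

/-- A function of the coordinates near `x₀`, multiplied by a cutoff function. -/
def cutoffComp (x₀ : M) (χ : C^∞⟮𝓘(ℝ, E), M; ℝ⟯) (hχ : tsupport χ ⊆ (chartAt E x₀).source)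
    (f : E → ℝ) (hf : ContDiff ℝ ∞ f) : C^∞⟮𝓘(ℝ, E), M; ℝ⟯ :=
  cutoffMul χ (fun x => f (extChartAt 𝓘(ℝ, E) x₀ x)) fun _ hx =>
    hf.contMDiff.contMDiffAt.comp _ (contMDiffAt_extChartAt' (hχ hx))

theorem cutoffComp_apply {x₀ : M} {χ : C^∞⟮𝓘(ℝ, E), M; ℝ⟯}
    {hχ : tsupport χ ⊆ (chartAt E x₀).source} {f : E → ℝ} {hf : ContDiff ℝ ∞ f} {x : M}
    (hx : χ x = 1) : cutoffComp x₀ χ hχ f hf x = f (extChartAt 𝓘(ℝ, E) x₀ x) := by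
  change χ x * _ = _
  rw [hx, one_mul]

theorem mvfderiv_cutoffComp {x₀ : M} {χ : C^∞⟮𝓘(ℝ, E), M; ℝ⟯}
    {hχ : tsupport χ ⊆ (chartAt E x₀).source} (l : E →L[ℝ] ℝ) {x : M}
    (hx : ∀ᶠ y in 𝓝 x, χ y = 1) (v : TangentSpace 𝓘(ℝ, E) x) :
    mvfderiv 𝓘(ℝ, E) (cutoffComp x₀ χ hχ l l.contDiff) x v =
      l (trivializationAt E (TangentSpace 𝓘(ℝ, E)) x₀ ⟨x, v⟩).2 := by
  have hxs : x ∈ (chartAt E x₀).source := hχ (subset_tsupport _ (by simp [hx.self_of_nhds]))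
  have h1 : (cutoffComp x₀ χ hχ l l.contDiff : M → ℝ) =ᶠ[𝓝 x]
      fun y => l (extChartAt 𝓘(ℝ, E) x₀ y) := by
    filter_upwards [hx] with y hy using cutoffComp_apply hy
  have h2 : MDifferentiableAt 𝓘(ℝ, E) 𝓘(ℝ, E) (extChartAt 𝓘(ℝ, E) x₀) x :=
    (contMDiffAt_extChartAt' hxs : ContMDiffAt 𝓘(ℝ, E) 𝓘(ℝ, E) ∞ _ x).mdifferentiableAt (by simp)
  have h3 : HasMFDerivAt 𝓘(ℝ, E) 𝓘(ℝ, ℝ) (fun y => l (extChartAt 𝓘(ℝ, E) x₀ y)) x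
      (l.comp (mfderiv 𝓘(ℝ, E) 𝓘(ℝ, E) (extChartAt 𝓘(ℝ, E) x₀) x)) :=
    l.hasMFDerivAt.comp x h2.hasMFDerivAt
  change mfderiv 𝓘(ℝ, E) 𝓘(ℝ, ℝ) (cutoffComp x₀ χ hχ l l.contDiff : M → ℝ) x v = _
  rw [h1.mfderiv_eq, h3.mfderiv, h2.mfderiv]
  rfl

/-- Hadamard's lemma in a chart. In coordinates `f` lives only on the chart target, so it is first
multiplied by a bump `ψ` supported there; the expansion then holds where `ψ = 1`. -/
theorem exists_hadamard (x₀ : M) {χ : C^∞⟮𝓘(ℝ, E), M; ℝ⟯}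
    (hχ : tsupport χ ⊆ (chartAt E x₀).source) (hχ1 : ∀ᶠ y in 𝓝 x₀, χ y = 1) {ι : Type*} [Fintype ι]
    (b : Module.Basis ι ℝ E) (f : C^∞⟮𝓘(ℝ, E), M; ℝ⟯) :
    ∃ h : ι → C^∞⟮𝓘(ℝ, E), M; ℝ⟯, ∀ᶠ x in 𝓝 x₀, f x = f x₀ + ∑ i,
      (cutoffComp x₀ χ hχ _ (b.coord i).toContinuousLinearMap.contDiff x -
        cutoffComp x₀ χ hχ _ (b.coord i).toContinuousLinearMap.contDiff x₀) * h i x := by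
  let c := extChartAt 𝓘(ℝ, E) x₀ x₀
  have ht : (extChartAt 𝓘(ℝ, E) x₀).target ∈ 𝓝 c := extChartAt_target_mem_nhds x₀
  obtain ⟨r, hr, hrt⟩ := Metric.nhds_basis_closedBall.mem_iff.1 ht
  let ψ : ContDiffBump c := ⟨r / 2, r, half_pos hr, half_lt_self hr⟩
  have hF : ContDiff ℝ ∞ fun y => ψ y * f ((extChartAt 𝓘(ℝ, E) x₀).symm y) := by
    rw [← contMDiff_iff_contDiff]
    refine contMDiff_of_tsupport fun y hy => ?_
    have hy' := hrt (ψ.tsupport_eq ▸ tsupport_mul_subset_left hy)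
    exact ψ.contDiff.contMDiff.contMDiffAt.mul (f.contMDiff.contMDiffAt.comp y
      ((contMDiffOn_extChartAt_symm x₀).contMDiffAt
        ((isOpen_extChartAt_target x₀).mem_nhds hy')))
  obtain ⟨G, hG, hfG⟩ := exists_contDiff_eq_add_apply_sub hF c
  refine ⟨fun i => cutoffComp x₀ χ hχ (fun y => G y (b i)) (by fun_prop), ?_⟩
  have hball : ∀ᶠ x in 𝓝 x₀, extChartAt 𝓘(ℝ, E) x₀ x ∈ Metric.closedBall c (r / 2) :=
    (continuousAt_extChartAt x₀).eventually (Metric.closedBall_mem_nhds c (half_pos hr))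
  filter_upwards [hχ1, hball, extChartAt_source_mem_nhds (I := 𝓘(ℝ, E)) x₀] with x hx1 hx2 hx3
  have h := hfG (extChartAt 𝓘(ℝ, E) x₀ x)
  rw [ψ.one_of_mem_closedBall hx2, ψ.one_of_mem_closedBall
    (Metric.mem_closedBall_self (half_pos hr).le), one_mul, one_mul,
    (extChartAt 𝓘(ℝ, E) x₀).left_inv hx3, extChartAt_to_inv] at h
  rw [h]
  congr 1
  conv_lhs => rw [← b.sum_repr (extChartAt 𝓘(ℝ, E) x₀ x - c)]
  simp only [map_sum, map_smul, cutoffComp_apply hx1, cutoffComp_apply hχ1.self_of_nhds]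
  refine Finset.sum_congr rfl fun i _ => ?_
  rw [map_sub]
  rfl

/-- A linear functional on `C^∞(M)` which is a derivation at `x₀` and vanishes on coordinates is
zero. -/
theorem pointDerivation_eq_zero (x₀ : M) {χ : C^∞⟮𝓘(ℝ, E), M; ℝ⟯}
    (hχ : tsupport χ ⊆ (chartAt E x₀).source) (hχ1 : ∀ᶠ y in 𝓝 x₀, χ y = 1) {ι : Type*} [Fintype ι]
    (b : Module.Basis ι ℝ E) (l : C^∞⟮𝓘(ℝ, E), M; ℝ⟯ →ₗ[ℝ] ℝ)
    (hl : ∀ f g, l (f * g) = f x₀ * l g + g x₀ * l f)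
    (h0 : ∀ i, l (cutoffComp x₀ χ hχ _ (b.coord i).toContinuousLinearMap.contDiff) = 0) : l = 0 := by
  have hone : l 1 = 0 := by
    have := hl 1 1
    simpa using this
  -- Locality: a cutoff `ψ` supported where `f` vanishes gives `ψ f = 0`, and the product rule at
  -- `x₀` with `ψ x₀ = 1` leaves `l f = 0`.
  have hloc (f : C^∞⟮𝓘(ℝ, E), M; ℝ⟯) (hf : ∀ᶠ x in 𝓝 x₀, f x = 0) : l f = 0 := by
    obtain ⟨ψ, hψ1, hψ⟩ := exists_cutoff E hf
    have h : ψ * f = 0 := by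
      ext x
      change ψ x * f x = 0
      by_cases hx : x ∈ tsupport ψ
      · rw [hψ hx, mul_zero]
      · rw [image_eq_zero_of_notMem_tsupport hx, zero_mul]
    have h' := hl ψ f
    rw [h, map_zero, hψ1.self_of_nhds, hf.self_of_nhds] at h'
    simpa using h'.symm
  ext f
  obtain ⟨h, hh⟩ := exists_hadamard x₀ hχ hχ1 b f
  let u (i : ι) := cutoffComp x₀ χ hχ _ (b.coord i).toContinuousLinearMap.contDiff
  -- By locality `l` may be applied to the Hadamard expansion. In each product, `u i - u i x₀`
  -- vanishes at `x₀` and is annihilated by `l`.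
  have hz := hloc (f - (f x₀ • 1 + ∑ i, (u i - u i x₀ • 1) * h i)) (by
    filter_upwards [hh] with x hx
    have hsum := congrFun (map_sum (ContMDiffMap.coeFnRingHom (I := 𝓘(ℝ, E)) (N := M) (n := ∞))
      (fun i => (u i - u i x₀ • (1 : C^∞⟮𝓘(ℝ, E), M; ℝ⟯)) * h i) Finset.univ) x
    rw [Finset.sum_apply] at hsum
    change f x - (f x₀ * 1 + (∑ i, (u i - u i x₀ • (1 : C^∞⟮𝓘(ℝ, E), M; ℝ⟯)) * h i) x) = 0
    rw [hx, mul_one, sub_eq_zero]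
    congr 1
    refine Eq.trans ?_ hsum.symm
    refine Finset.sum_congr rfl fun i _ => ?_
    change _ = (u i x - u i x₀ * 1) * h i x
    rw [mul_one])
  rw [map_sub, map_add, map_sum, map_smul, hone, smul_zero, zero_add, sub_eq_zero] at hz
  rw [hz, LinearMap.zero_apply]
  refine Finset.sum_eq_zero fun i _ => ?_
  have h1 : (u i - u i x₀ • (1 : C^∞⟮𝓘(ℝ, E), M; ℝ⟯)) x₀ = 0 := by
    change u i x₀ - u i x₀ * 1 = 0
    ring
  rw [hl, h1, map_sub, map_smul, hone, h0]
  simp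

/-- Evaluation of functions at a point. -/
def evalLin (x : M) : C^∞⟮𝓘(ℝ, E), M; ℝ⟯ →ₗ[ℝ] ℝ where
  toFun f := f x
  map_add' _ _ := rfl
  map_smul' _ _ := rfl

/-- Global functions that serve as coordinates near `x₀`: their differentials read off the
components of tangent vectors, and a derivation at `x₀` is determined by its values on them. -/
theorem exists_eventually_sum_coord (x₀ : M) {ι : Type*} [Fintype ι] (b : Module.Basis ι ℝ E) :
    ∃ u : ι → C^∞⟮𝓘(ℝ, E), M; ℝ⟯,
      (∀ᶠ x in 𝓝 x₀, ∀ (v : TangentSpace 𝓘(ℝ, E) x) (i : ι), mvfderiv 𝓘(ℝ, E) (u i) x v =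
        b.coord i (trivializationAt E (TangentSpace 𝓘(ℝ, E)) x₀ ⟨x, v⟩).2) ∧
      ∀ l : C^∞⟮𝓘(ℝ, E), M; ℝ⟯ →ₗ[ℝ] ℝ, (∀ f g, l (f * g) = f x₀ * l g + g x₀ * l f) →
        (∀ i, l (u i) = 0) → l = 0 := by
  obtain ⟨χ, hχ1, hχ⟩ := exists_cutoff E (chart_source_mem_nhds E x₀)
  refine ⟨fun i => cutoffComp x₀ χ hχ _ (b.coord i).toContinuousLinearMap.contDiff, ?_,
    pointDerivation_eq_zero x₀ hχ hχ1 b⟩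
  filter_upwards [hχ1.eventually_nhds] with x hx v i
  exact mvfderiv_cutoffComp (b.coord i).toContinuousLinearMap hx v

theorem tangent_ext {x : M} {v w : TangentSpace 𝓘(ℝ, E) x}
    (h : ∀ f : C^∞⟮𝓘(ℝ, E), M; ℝ⟯, mvfderiv 𝓘(ℝ, E) f x v = mvfderiv 𝓘(ℝ, E) f x w) : v = w := by
  obtain ⟨u, hu, -⟩ := exists_eventually_sum_coord x (Module.finBasis ℝ E)
  have hx : x ∈ (trivializationAt E (TangentSpace 𝓘(ℝ, E)) x).baseSet :=
    FiberBundle.mem_baseSet_trivializationAt' x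
  apply ((trivializationAt E (TangentSpace 𝓘(ℝ, E)) x).continuousLinearEquivAt ℝ x hx).injective
  refine (Module.finBasis ℝ E).ext_elem fun i => ?_
  have := h (u i)
  rwa [hu.self_of_nhds, hu.self_of_nhds] at this

theorem vfDeriv_apply
    (v : Cₛ^∞⟮𝓘(ℝ, E); E, (TangentSpace 𝓘(ℝ, E) : M → Type _)⟯) (f : C^∞⟮𝓘(ℝ, E), M; ℝ⟯) (x : M) :
    vfDeriv v f x = mvfderiv 𝓘(ℝ, E) f x (v x) := rfl

theorem vfDeriv_injective : Function.Injective
    (vfDeriv : Cₛ^∞⟮𝓘(ℝ, E); E, (TangentSpace 𝓘(ℝ, E) : M → Type _)⟯ → _) := by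
  intro v w h
  ext x
  refine tangent_ext fun f => ?_
  rw [← vfDeriv_apply, ← vfDeriv_apply, h]

/-- Every derivation of `C^∞(M)` is given by a smooth vector field. -/
theorem vfDeriv_surjective : Function.Surjective
    (vfDeriv : Cₛ^∞⟮𝓘(ℝ, E); E, (TangentSpace 𝓘(ℝ, E) : M → Type _)⟯ → _) := by
  intro D
  let b := Module.finBasis ℝ E
  have hv (x : M) : ∃ v : TangentSpace 𝓘(ℝ, E) x, ∀ f : C^∞⟮𝓘(ℝ, E), M; ℝ⟯,
      mvfderiv 𝓘(ℝ, E) f x v = D f x := by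
    obtain ⟨u, hu, hl⟩ := exists_eventually_sum_coord x b
    let e := trivializationAt E (TangentSpace 𝓘(ℝ, E)) x
    have hx : x ∈ e.baseSet := FiberBundle.mem_baseSet_trivializationAt' x
    -- The vector is prescribed by the values of `D` on coordinates. Extending it to a field makes
    -- `D - vfDeriv V` a derivation, which at `x` kills the coordinates and hence vanishes there.
    obtain ⟨V, hV⟩ := exists_section_apply_eq E E x (e.symm x (∑ i, D (u i) x • b i))
    refine ⟨V x, fun f => ?_⟩
    have h0 := hl (evalLin x ∘ₗ (D - vfDeriv V : Derivation ℝ _ _).toLinearMap)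
      (fun f g => congrArg (evalLin x) ((D - vfDeriv V).leibniz f g)) fun i => by
        change D (u i) x - mvfderiv 𝓘(ℝ, E) (u i) x (V x) = 0
        rw [hu.self_of_nhds, hV, e.apply_mk_symm hx, Module.Basis.coord_apply, b.repr_sum_self,
          sub_self]
    exact (sub_eq_zero.1 (DFunLike.congr_fun h0 f)).symm
  choose v hv using hv
  have hsm : ContMDiff 𝓘(ℝ, E) (𝓘(ℝ, E).prod 𝓘(ℝ, E)) ∞
      fun x => TotalSpace.mk' E (E := (TangentSpace 𝓘(ℝ, E) : M → Type _)) x (v x) := by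
    intro x₀
    obtain ⟨u, hu, -⟩ := exists_eventually_sum_coord x₀ b
    rw [contMDiffAt_section]
    -- The components of `v` near `x₀` are the smooth functions `D (u i)`.
    have hs : ContMDiffAt 𝓘(ℝ, E) 𝓘(ℝ, E) ∞ (fun x => ∑ i, D (u i) x • b i) x₀ :=
      ContMDiffAt.sum fun i _ => (D (u i)).contMDiff.contMDiffAt.smul contMDiffAt_const
    refine hs.congr_of_eventuallyEq ?_
    filter_upwards [hu] with x hx
    refine b.ext_elem fun i => ?_
    have := hx (v x) i
    rw [hv, Module.Basis.coord_apply] at this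
    rw [b.repr_sum_self, ← this]
  exact ⟨⟨v, hsm⟩, by ext f x; exact hv x f⟩

end Derivations

end

/-! ### From Lie-Rinehart structures to Lie algebroids and dual bundles -/

section

/-- Transport of a Lie-Rinehart structure along an isomorphism of modules. -/
def LieRinehartStr.transport {C L L' : Type*} [CommRing C] [Algebra ℝ C] [AddCommGroup L]
    [Module ℝ L] [Module C L] [IsScalarTower ℝ C L] [AddCommGroup L'] [Module ℝ L'] [Module C L']
    [IsScalarTower ℝ C L'] (S : LieRinehartStr C L) (φ : L' ≃ₗ[C] L) : LieRinehartStr C L' where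
  bracket := (S.bracket.compl₁₂ (φ.restrictScalars ℝ).toLinearMap
    (φ.restrictScalars ℝ).toLinearMap).compr₂ (φ.symm.restrictScalars ℝ).toLinearMap
  anchor := S.anchor ∘ₗ φ.toLinearMap
  bracket_self X := by
    change φ.symm (S.bracket (φ X) (φ X)) = 0
    rw [S.bracket_self, map_zero]
  jacobi X Y Z := by
    change φ.symm (S.bracket (φ X) (φ (φ.symm (S.bracket (φ Y) (φ Z))))) =
      φ.symm (S.bracket (φ (φ.symm (S.bracket (φ X) (φ Y)))) (φ Z)) +
        φ.symm (S.bracket (φ Y) (φ (φ.symm (S.bracket (φ X) (φ Z)))))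
    simp only [LinearEquiv.apply_symm_apply, ← map_add, ← S.jacobi]
  leibniz X f Y := by
    change φ.symm (S.bracket (φ X) (φ (f • Y))) =
      f • φ.symm (S.bracket (φ X) (φ Y)) + S.anchor (φ X) f • Y
    rw [map_smul, S.leibniz, map_add, map_smul, map_smul, φ.symm_apply_apply]
  anchor_bracket X Y f := by
    change S.anchor (φ (φ.symm (S.bracket (φ X) (φ Y)))) f = _
    rw [φ.apply_symm_apply]
    exact S.anchor_bracket _ _ f

section Geometry

variable {E : Type*} [NormedAddCommGroup E] [NormedSpace ℝ E] [FiniteDimensional ℝ E]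
  {M : Type*} [TopologicalSpace M] [T2Space M] [ChartedSpace E M] [IsManifold 𝓘(ℝ, E) ∞ M]
  {F : Type*} [NormedAddCommGroup F] [NormedSpace ℝ F] [FiniteDimensional ℝ F]
  {V : M → Type*} [TopologicalSpace (Bundle.TotalSpace F V)] [∀ x, TopologicalSpace (V x)]
  [FiberBundle F V] [∀ x, AddCommGroup (V x)] [∀ x, Module ℝ (V x)] [VectorBundle ℝ F V]
  [ContMDiffVectorBundle ∞ F V 𝓘(ℝ, E)]

/-- A Lie-Rinehart structure on the module of sections comes from a Lie algebroid. -/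
theorem LieRinehartStr.exists_lieAlgebroid
    (S : LieRinehartStr C^∞⟮𝓘(ℝ, E), M; ℝ⟯ Cₛ^∞⟮𝓘(ℝ, E); F, V⟯) :
    ∃ 𝓑 : LieAlgebroid E F V, (∀ X Y, 𝓑.bracket X Y = S.bracket X Y) ∧
      ∀ X, vfDeriv (𝓑.anchorField X) = S.anchor X := by
  -- Each derivation `S.anchor X` is a unique vector field. Uniqueness makes the assignment
  -- `C^∞(M)`-linear, so it comes from a bundle map.
  choose v hv using fun X => vfDeriv_surjective (S.anchor X)
  let T : Cₛ^∞⟮𝓘(ℝ, E); F, V⟯ →ₗ[C^∞⟮𝓘(ℝ, E), M; ℝ⟯]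
      Cₛ^∞⟮𝓘(ℝ, E); E, (TangentSpace 𝓘(ℝ, E) : M → Type _)⟯ :=
    { toFun := v
      map_add' := fun X Y => by
        apply vfDeriv_injective
        rw [hv, map_add, ← hv, ← hv]
        ext f x
        exact (map_add (mvfderiv 𝓘(ℝ, E) f x) _ _).symm
      map_smul' := fun g X => by
        apply vfDeriv_injective
        rw [hv, map_smul, ← hv]
        ext f x
        exact (map_smul (mvfderiv 𝓘(ℝ, E) f x) _ _).symm }
  obtain ⟨a, ha⟩ := exists_bundleMap T
  have ha' (X) : vfDeriv (bundleMapApply a X) = S.anchor X := by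
    rw [← hv]
    congr 1
    ext x
    exact ha X x
  refine ⟨⟨S.bracket, a, S.bracket_self, S.jacobi, fun X f Y => ?_, fun X Y f => ?_⟩,
    fun _ _ => rfl, ha'⟩
  · rw [ha', S.leibniz]
  · rw [ha', ha', ha', S.anchor_bracket]

variable (E F V) in
/-- Sections of the dual bundle are linear forms on the module of sections. -/
def pairingEquiv : Cₛ^∞⟮𝓘(ℝ, E); F →L[ℝ] ℝ, (DualBundle V : M → Type _)⟯
    ≃ₗ[C^∞⟮𝓘(ℝ, E), M; ℝ⟯] Module.Dual C^∞⟮𝓘(ℝ, E), M; ℝ⟯ Cₛ^∞⟮𝓘(ℝ, E); F, V⟯ :=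
  LinearEquiv.ofBijective
    { toFun := pairing
      map_add' := fun _ _ => rfl
      map_smul' := fun _ _ => rfl } <| by
    constructor
    · intro α β h
      ext x v
      obtain ⟨s, rfl⟩ := exists_section_apply_eq E F x v
      exact congrArg (fun f : C^∞⟮𝓘(ℝ, E), M; ℝ⟯ => f x) (DFunLike.congr_fun h s)
    · intro l
      -- For surjectivity, a linear form is regarded as a map into sections of the trivial line
      -- bundle; the bundle map inducing it is a section of the dual.
      let T : Cₛ^∞⟮𝓘(ℝ, E); F, V⟯ →ₗ[C^∞⟮𝓘(ℝ, E), M; ℝ⟯]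
          Cₛ^∞⟮𝓘(ℝ, E); ℝ, (Bundle.Trivial M ℝ)⟯ :=
        { toFun := fun s => ⟨fun x => l s x, fun x =>
            Bundle.contMDiffAt_totalSpace.2 ⟨contMDiffAt_id, (l s).contMDiff x⟩⟩
          map_add' := fun s t => by ext x; exact congrArg (evalLin x) (map_add l s t)
          map_smul' := fun f s => by ext x; exact congrArg (evalLin x) (map_smul l f s) }
      obtain ⟨α, hα⟩ := exists_bundleMap T
      refine ⟨α, ?_⟩
      ext s x
      exact hα s x

theorem pairingEquiv_apply (α : Cₛ^∞⟮𝓘(ℝ, E); F →L[ℝ] ℝ, (DualBundle V : M → Type _)⟯) :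
    pairingEquiv E F V α = pairing α := rfl

theorem pairing_pairingEquiv_symm
    (l : Module.Dual C^∞⟮𝓘(ℝ, E), M; ℝ⟯ Cₛ^∞⟮𝓘(ℝ, E); F, V⟯) :
    pairing ((pairingEquiv E F V).symm l) = l := (pairingEquiv E F V).apply_symm_apply l

/-- A differential on `Γ(∧V)` defines a Lie algebroid structure on the dual bundle. -/
theorem exists_dual_lieAlgebroid {d : ExteriorSections E F V → ExteriorSections E F V}
    (hd : IsDegreeOneDerivation d) (hsq : ∀ P, d (d P) = 0) :
    ∃ 𝓑 : LieAlgebroid E (F →L[ℝ] ℝ) (DualBundle V),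
      (∀ α β, pairing (𝓑.bracket α β) = (hd.lie (pairing α)).dual (pairing β)) ∧
      ∀ α, vfDeriv (𝓑.anchorField α) = hd.anchor (pairing α) := by
  obtain ⟨𝓑, hb, ha⟩ := ((hd.dualLieRinehart hsq).transport (pairingEquiv E F V)).exists_lieAlgebroid
  refine ⟨𝓑, fun α β => ?_, ha⟩
  rw [hb]
  exact pairing_pairingEquiv_symm _

theorem isDifferentialOfDual {d : ExteriorSections E F V → ExteriorSections E F V}
    {hd : IsDegreeOneDerivation d} (hsq : ∀ P, d (d P) = 0)
    {𝓑 : LieAlgebroid E (F →L[ℝ] ℝ) (DualBundle V)}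
    (hb : ∀ α β, pairing (𝓑.bracket α β) = (hd.lie (pairing α)).dual (pairing β))
    (ha : ∀ α, vfDeriv (𝓑.anchorField α) = hd.anchor (pairing α)) :
    IsDifferentialOfDual 𝓑 d where
  toIsDegreeOneDerivation := hd
  sq_zero := hsq
  apply_fun f α := by
    rw [ha]
    rfl
  apply_section X α β := by
    rw [hb, ha, ha, hd.lie_dual_apply, sub_sub_cancel]
    rfl

end Geometry

theorem LieRinehartStr.lieDerivation_dual_apply {C L : Type*} [CommRing C] [Algebra ℝ C]
    [AddCommGroup L] [Module ℝ L] [Module C L] [IsScalarTower ℝ C L] (S : LieRinehartStr C L)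
    (X : L) (β : Module.Dual C L) (Y : L) :
    (S.lieDerivation X).dual β Y = S.anchor X (β Y) - β (S.bracket X Y) := rfl

theorem LieRinehartStr.lieDerivation_add_dual {C L : Type*} [CommRing C] [Algebra ℝ C]
    [AddCommGroup L] [Module ℝ L] [Module C L] [IsScalarTower ℝ C L] (S : LieRinehartStr C L)
    (X Y : L) (β : Module.Dual C L) : (S.lieDerivation (X + Y)).dual β =
      (S.lieDerivation X).dual β + (S.lieDerivation Y).dual β := by
  ext Z
  simp only [LinearMap.add_apply, lieDerivation_dual_apply, map_add, Derivation.add_apply]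
  abel

theorem LieRinehartStr.lieDerivation_smul_dual {C L : Type*} [CommRing C] [Algebra ℝ C]
    [AddCommGroup L] [Module ℝ L] [Module C L] [IsScalarTower ℝ C L] (S : LieRinehartStr C L)
    (r : ℝ) (X : L) (β : Module.Dual C L) :
    (S.lieDerivation (r • X)).dual β = r • (S.lieDerivation X).dual β := by
  ext Z
  simp only [LinearMap.smul_apply, lieDerivation_dual_apply, map_smul, smul_sub,
    LinearMap.map_smul_of_tower, Derivation.smul_apply]

/-- Follows from the Jacobi identity and the anchor being a morphism; it makes the dual action of
`𝔤` a representation. -/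
theorem LieRinehartStr.lieDerivation_bracket_dual {C L : Type*} [CommRing C] [Algebra ℝ C]
    [AddCommGroup L] [Module ℝ L] [Module C L] [IsScalarTower ℝ C L] (S : LieRinehartStr C L)
    (X Y : L) (β : Module.Dual C L) : (S.lieDerivation (S.bracket X Y)).dual β =
      (S.lieDerivation X).dual ((S.lieDerivation Y).dual β) -
        (S.lieDerivation Y).dual ((S.lieDerivation X).dual β) := by
  ext Z
  simp only [LinearMap.sub_apply, lieDerivation_dual_apply, S.anchor_bracket, map_sub]
  rw [eq_sub_of_add_eq (S.jacobi X Y Z).symm, map_sub]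
  abel

section Evaluation

variable {E : Type*} [NormedAddCommGroup E] [NormedSpace ℝ E] [FiniteDimensional ℝ E]
  {M : Type*} [TopologicalSpace M] [T2Space M] [ChartedSpace E M] [IsManifold 𝓘(ℝ, E) ∞ M]
  {F : Type*} [NormedAddCommGroup F] [NormedSpace ℝ F] [FiniteDimensional ℝ F]
  {A : M → Type*} [TopologicalSpace (Bundle.TotalSpace F A)] [∀ x, TopologicalSpace (A x)]
  [FiberBundle F A] [∀ x, AddCommGroup (A x)] [∀ x, Module ℝ (A x)] [VectorBundle ℝ F A]
  [ContMDiffVectorBundle ∞ F A 𝓘(ℝ, E)]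

theorem eval₂_ι_mul_ι (X Y : Cₛ^∞⟮𝓘(ℝ, E); F, A⟯)
    (α β : Cₛ^∞⟮𝓘(ℝ, E); F →L[ℝ] ℝ, (DualBundle A : M → Type _)⟯) (x : M) :
    eval₂ (ExteriorAlgebra.ι _ X * ExteriorAlgebra.ι _ Y) α β x =
      pairing α X x * pairing β Y x - pairing β X x * pairing α Y x := by
  have h : contr (pairing β) (contr (pairing α)
      (ExteriorAlgebra.ι _ X * ExteriorAlgebra.ι _ Y)) =
        algebraMap _ _ (pairing α X * pairing β Y - pairing β X * pairing α Y) := by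
    rw [contr_ι_mul, contr_ι, ← Algebra.commutes, ← Algebra.smul_def, map_sub, contr_smul_apply,
      contr_smul_apply, contr_ι, contr_ι]
    simp only [Algebra.smul_def, map_sub, map_mul]
    rw [Algebra.commutes (pairing α Y)]
  exact congrArg (evalLin x) ((congrArg ExteriorAlgebra.algebraMapInv h).trans
    (ExteriorAlgebra.algebraMap_leftInverse _ _))

/-- The value of `eval₂` at a point, as a real linear map. -/
def eval₂Lin (α β : Cₛ^∞⟮𝓘(ℝ, E); F →L[ℝ] ℝ, (DualBundle A : M → Type _)⟯) (x : M) :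
    ExteriorSections E F A →ₗ[ℝ] ℝ :=
  evalLin x ∘ₗ ((ExteriorAlgebra.algebraMapInv (R := C^∞⟮𝓘(ℝ, E), M; ℝ⟯)
    (M := Cₛ^∞⟮𝓘(ℝ, E); F, A⟯)).toLinearMap ∘ₗ
      CliffordAlgebra.contractLeft (pairing β) ∘ₗ
        CliffordAlgebra.contractLeft (pairing α)).restrictScalars ℝ

theorem eval₂Lin_apply (α β : Cₛ^∞⟮𝓘(ℝ, E); F →L[ℝ] ℝ, (DualBundle A : M → Type _)⟯) (x : M)
    (P : ExteriorSections E F A) : eval₂Lin α β x P = eval₂ P α β x := rfl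

end Evaluation

/-! ### The dual Lie algebroid of a quasi-Poisson bialgebroid -/

namespace QuasiPoissonBialgebroid

variable {E : Type*} [NormedAddCommGroup E] [NormedSpace ℝ E] [FiniteDimensional ℝ E]
  {M : Type*} [TopologicalSpace M] [T2Space M] [ChartedSpace E M] [IsManifold 𝓘(ℝ, E) ∞ M]
  {F : Type*} [NormedAddCommGroup F] [NormedSpace ℝ F] [FiniteDimensional ℝ F]
  {A : M → Type*} [TopologicalSpace (Bundle.TotalSpace F A)] [∀ x, TopologicalSpace (A x)]
  [FiberBundle F A] [∀ x, AddCommGroup (A x)] [∀ x, Module ℝ (A x)] [VectorBundle ℝ F A]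
  [ContMDiffVectorBundle ∞ F A 𝓘(ℝ, E)]
  {𝔤 : Type*} [LieRing 𝔤] [LieAlgebra ℝ 𝔤] [FiniteDimensional ℝ 𝔤]
  {B : LinearMap.BilinForm ℝ 𝔤} {hB : B.Nondegenerate}
  {act : InfinitesimalAction E M 𝔤} (Q : QuasiPoissonBialgebroid F A B hB act)

theorem extendExterior_ι (ρ : 𝔤 →ₗ[ℝ] Cₛ^∞⟮𝓘(ℝ, E); F, A⟯) (ξ : 𝔤) :
    extendExterior ρ (ExteriorAlgebra.ι ℝ ξ) = ExteriorAlgebra.ι _ (ρ ξ) :=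
  ExteriorAlgebra.lift_ι_apply ℝ _ _ ξ

section Differential

variable {ι κ : Type*} [Fintype ι] [DecidableEq ι] [Fintype κ] [DecidableEq κ]

theorem dualDifferential_eq (e : Module.Basis ι ℝ 𝔤) :
    Q.dualDifferential e = fun P => Q.𝒟 P + (1 / 2 : ℝ) •
      Q.algebroid.toLieRinehart.casimir Q.ρ e (B.dualBasis hB e) P := by
  funext P
  simp only [dualDifferential, LieRinehartStr.schouten_ι]
  rfl

theorem isDegreeOneDerivation_dualDifferential (e : Module.Basis ι ℝ 𝔤) :
    IsDegreeOneDerivation (Q.dualDifferential e) := by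
  rw [dualDifferential_eq]
  exact LieRinehartStr.isDegreeOneDerivation_add_casimir Q.derivation

variable (hB_symm : B.IsSymm)
include hB_symm

theorem dualDifferential_eq_dualDifferential (e : Module.Basis ι ℝ 𝔤) (f : Module.Basis κ ℝ 𝔤) :
    Q.dualDifferential e = Q.dualDifferential f := by
  rw [dualDifferential_eq, dualDifferential_eq]
  funext P
  rw [LieRinehartStr.casimir_eq hB_symm (isDualPair_dualBasis hB_symm hB e)
    (isDualPair_dualBasis hB_symm hB f)]

variable (hB_inv : ∀ ξ η ζ : 𝔤, B ⁅ξ, η⁆ ζ = B ξ ⁅η, ζ⁆)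
include hB_inv

/-- The constant is `1/8 = 1/2 · 1/12 · 3`: from `𝒟_sq`, from the trivector, and from
`schouten_cartan`. -/
theorem 𝒟_sq_eq_cubicCasimir (P : ExteriorSections E F A) :
    Q.𝒟 (Q.𝒟 P) = (1 / 8 : ℝ) • Q.algebroid.toLieRinehart.cubicCasimir Q.ρ
      (Module.finBasis ℝ 𝔤) (B.dualBasis hB (Module.finBasis ℝ 𝔤)) P := by
  have h := LieRinehartStr.schouten_cartan (S := Q.algebroid.toLieRinehart) (ρ := Q.ρ) hB_symm
    hB_inv (isDualPair_dualBasis hB_symm hB (Module.finBasis ℝ 𝔤)) P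
  have hφ : extendExterior Q.ρ (cartanTrivector B hB) = (1 / 12 : ℝ) • ∑ i, ∑ j, ∑ k,
      B (B.dualBasis hB (Module.finBasis ℝ 𝔤) i) ⁅B.dualBasis hB (Module.finBasis ℝ 𝔤) j,
        B.dualBasis hB (Module.finBasis ℝ 𝔤) k⁆ •
      (ExteriorAlgebra.ι C^∞⟮𝓘(ℝ, E), M; ℝ⟯ (Q.ρ (Module.finBasis ℝ 𝔤 i)) *
        ExteriorAlgebra.ι _ (Q.ρ (Module.finBasis ℝ 𝔤 j)) *
        ExteriorAlgebra.ι _ (Q.ρ (Module.finBasis ℝ 𝔤 k))) := by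
    simp only [cartanTrivector, map_smul, map_sum, map_mul, extendExterior_ι]
  rw [Q.𝒟_sq, hφ, LieRinehartStr.schouten_real_smul, h, smul_smul, smul_smul]
  norm_num

/-- The basis is the one used in `cartanTrivector`; other bases are reduced to it by
`dualDifferential_eq_dualDifferential`. -/
theorem dualDifferential_sq (P : ExteriorSections E F A) :
    Q.dualDifferential (Module.finBasis ℝ 𝔤) (Q.dualDifferential (Module.finBasis ℝ 𝔤) P) = 0 := by
  rw [dualDifferential_eq]
  exact LieRinehartStr.add_casimir_sq hB_symm hB_inv Q.ρ_lie Q.derivation Q.𝒟_ρ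
    (isDualPair_dualBasis hB_symm hB _) (Q.𝒟_sq_eq_cubicCasimir hB_symm hB_inv) P

theorem lieDer_dualDifferential (e : Module.Basis ι ℝ 𝔤) (ξ : 𝔤) (P : ExteriorSections E F A) :
    Q.algebroid.toLieRinehart.lieDer (Q.ρ ξ) (Q.dualDifferential e P) =
      Q.dualDifferential e (Q.algebroid.toLieRinehart.lieDer (Q.ρ ξ) P) := by
  rw [dualDifferential_eq]
  exact LieRinehartStr.lieDer_add_casimir hB_symm hB_inv Q.ρ_lie Q.derivation Q.𝒟_ρ
    (isDualPair_dualBasis hB_symm hB _) ξ P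

end Differential

/-- The action of `𝔤` on sections of the dual bundle. -/
def dualAction : 𝔤 →ₗ[ℝ] Module.End ℝ Cₛ^∞⟮𝓘(ℝ, E); F →L[ℝ] ℝ, (DualBundle A : M → Type _)⟯ :=
  LinearMap.mk₂ ℝ (fun ξ α => ((pairingEquiv E F A).restrictScalars ℝ).symm
      ((Q.algebroid.toLieRinehart.lieDerivation (Q.ρ ξ)).dual
        ((pairingEquiv E F A).restrictScalars ℝ α)))
    (fun ξ η α => by rw [map_add, LieRinehartStr.lieDerivation_add_dual, map_add])
    (fun r ξ α => by rw [map_smul, LieRinehartStr.lieDerivation_smul_dual, map_smul])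
    (fun ξ α β => by rw [map_add, map_add, map_add])
    (fun r ξ α => by rw [map_smul, ZeroDerivation.dual_real_smul, map_smul])

theorem pairing_dualAction (ξ : 𝔤) (α) : pairing (Q.dualAction ξ α) =
    (Q.algebroid.toLieRinehart.lieDerivation (Q.ρ ξ)).dual (pairing α) :=
  pairing_pairingEquiv_symm _

theorem isDualAction_dualAction : Q.IsDualAction Q.dualAction where
  lie ξ η α := by
    apply (pairingEquiv E F A).injective
    rw [map_sub]
    simp only [pairingEquiv_apply, pairing_dualAction]
    rw [Q.ρ_lie]
    exact Q.algebroid.toLieRinehart.lieDerivation_bracket_dual _ _ _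
  pairing ξ α X := by
    rw [pairing_dualAction, ← Q.anchor_ρ]
    rfl

theorem actionPreserves_dualAction {ι : Type*} [Fintype ι] [DecidableEq ι] (hB_symm : B.IsSymm)
    (hB_inv : ∀ ξ η ζ : 𝔤, B ⁅ξ, η⁆ ζ = B ξ ⁅η, ζ⁆) (e : Module.Basis ι ℝ 𝔤)
    {𝓑 : LieAlgebroid E (F →L[ℝ] ℝ) (DualBundle A)}
    (hb : ∀ α β, pairing (𝓑.bracket α β) =
      ((Q.isDegreeOneDerivation_dualDifferential e).lie (pairing α)).dual (pairing β))
    (ha : ∀ α, vfDeriv (𝓑.anchorField α) =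
      (Q.isDegreeOneDerivation_dualDifferential e).anchor (pairing α)) :
    ActionPreserves 𝓑 act Q.dualAction := by
  -- Both claims follow formally once `[ρ(ξ), ·]` commutes with the differential.
  have hD (ξ : 𝔤) : (Q.algebroid.toLieRinehart.lieDerivation (Q.ρ ξ)).op *
      (Q.isDegreeOneDerivation_dualDifferential e).toEnd =
      (Q.isDegreeOneDerivation_dualDifferential e).toEnd *
      (Q.algebroid.toLieRinehart.lieDerivation (Q.ρ ξ)).op :=
    AddMonoidHom.ext (Q.lieDer_dualDifferential hB_symm hB_inv e ξ)
  constructor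
  · intro ξ s t
    apply (pairingEquiv E F A).injective
    rw [map_add]
    simp only [pairingEquiv_apply, pairing_dualAction, hb]
    exact IsDegreeOneDerivation.dual_lie_dual _ _ (hD ξ) _ _
  · intro ξ s f
    rw [ha, pairing_dualAction, IsDegreeOneDerivation.anchor_dual _ _ (hD ξ), ha, ← Q.anchor_ρ]
    rfl

theorem apply_μ (x : M) (α : DualBundle A x) (ξ : 𝔤) : B (Q.μ x α) ξ = α (Q.ρ ξ x) :=
  LinearMap.BilinForm.apply_toDual_symm_apply (hB := hB) _ ξ

theorem pairing_ρ_apply (α : Cₛ^∞⟮𝓘(ℝ, E); F →L[ℝ] ℝ, (DualBundle A : M → Type _)⟯) (ξ : 𝔤)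
    (x : M) : pairing α (Q.ρ ξ) x = B (Q.μ x (α x)) ξ := (Q.apply_μ x (α x) ξ).symm

/-- `𝒟` contributes nothing on `ρ(ξ)`, which leaves `½ ∑ ρ(e^i) ∧ ρ([e_i, ξ])`. Its two pairings
with `α` and `β` coincide by skew-symmetry of the Lie bracket, which absorbs the `½`. -/
theorem eval₂_dualDifferential_ρ {ι : Type*} [Fintype ι] [DecidableEq ι] (hB_symm : B.IsSymm)
    (hB_inv : ∀ ξ η ζ : 𝔤, B ⁅ξ, η⁆ ζ = B ξ ⁅η, ζ⁆) (e : Module.Basis ι ℝ 𝔤)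
    (α β : Cₛ^∞⟮𝓘(ℝ, E); F →L[ℝ] ℝ, (DualBundle A : M → Type _)⟯) (ξ : 𝔤) (x : M) :
    eval₂ (Q.dualDifferential e (ExteriorAlgebra.ι _ (Q.ρ ξ))) α β x =
      -B ⁅Q.μ x (α x), Q.μ x (β x)⁆ ξ := by
  have he := isDualPair_dualBasis hB_symm hB e
  set e' := B.dualBasis hB e
  set m := Q.μ x (α x)
  set n := Q.μ x (β x)
  have hd : Q.dualDifferential e (ExteriorAlgebra.ι _ (Q.ρ ξ)) = (1 / 2 : ℝ) • ∑ i,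
      ExteriorAlgebra.ι _ (Q.ρ (e' i)) * ExteriorAlgebra.ι _ (Q.ρ ⁅e i, ξ⁆) := by
    simp only [dualDifferential, LieRinehartStr.schouten_ι, LieRinehartStr.lieDer_ι, Q.𝒟_ρ, zero_add,
      Q.ρ_lie]
    rfl
  have hlin : eval₂ (Q.dualDifferential e (ExteriorAlgebra.ι _ (Q.ρ ξ))) α β x =
      (1 / 2 : ℝ) * ∑ i, (B m (e' i) * B n ⁅e i, ξ⁆ - B n (e' i) * B m ⁅e i, ξ⁆) := by
    rw [hd, ← eval₂Lin_apply, map_smul, map_sum]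
    simp only [eval₂Lin_apply, eval₂_ι_mul_ι, pairing_ρ_apply, smul_eq_mul]
    rfl
  -- Invariance turns `⟨b, [e_i, ξ]⟩` into `⟨[b, e_i], ξ⟩`, and the sum reassembles `a` from its
  -- components.
  have hsum (a b : 𝔤) : ∑ i, B a (e' i) * B b ⁅e i, ξ⁆ = B ⁅b, a⁆ ξ := by
    conv_rhs => rw [← he.left a]
    simp only [lie_sum, lie_smul, map_sum, map_smul, LinearMap.sum_apply, LinearMap.smul_apply,
      smul_eq_mul, hB_inv, hB_symm.eq a]
  rw [hlin, Finset.sum_sub_distrib, hsum, hsum, ← lie_skew m n, map_neg, LinearMap.neg_apply]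
  ring

/-- Every linear form on `𝔤` is `⟨·, ξ⟩` for some `ξ`, and `⟨μ(α), ξ⟩ = α(ρ(ξ))`. The bracket
condition is therefore the formula for `(d ρ(ξ))(s, t)`, with its left side computed in
`eval₂_dualDifferential_ρ`. -/
theorem isMorphismToLieAlgebra_μ {ι : Type*} [Fintype ι] [DecidableEq ι] (hB_symm : B.IsSymm)
    (hB_inv : ∀ ξ η ζ : 𝔤, B ⁅ξ, η⁆ ζ = B ξ ⁅η, ζ⁆) (e : Module.Basis ι ℝ 𝔤)
    {𝓑 : LieAlgebroid E (F →L[ℝ] ℝ) (DualBundle A)}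
    (h𝓑 : IsDifferentialOfDual 𝓑 (Q.dualDifferential e)) :
    IsMorphismToLieAlgebra 𝓑 Q.μ := by
  have hl (l : Module.Dual ℝ 𝔤) : ∃ ξ, ∀ η, l η = B η ξ :=
    ⟨(B.toDual hB).symm l, fun η => by
      rw [hB_symm.eq, LinearMap.BilinForm.apply_toDual_symm_apply]⟩
  have hfun (ξ : 𝔤) (s : Cₛ^∞⟮𝓘(ℝ, E); F →L[ℝ] ℝ, (DualBundle A : M → Type _)⟯) :
      (fun x => B (Q.μ x (s x)) ξ) = pairing s (Q.ρ ξ) :=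
    funext fun x => (Q.pairing_ρ_apply s ξ x).symm
  constructor
  · intro l s
    obtain ⟨ξ, hξ⟩ := hl l
    simp only [hξ, hfun]
    exact (pairing s (Q.ρ ξ)).contMDiff
  · intro l s t x
    obtain ⟨ξ, hξ⟩ := hl l
    have h := congrArg (evalLin x) (h𝓑.apply_section (Q.ρ ξ) s t)
    rw [map_sub, map_sub] at h
    change eval₂ _ s t x = mvfderiv 𝓘(ℝ, E) (pairing t (Q.ρ ξ)) x (𝓑.anchor x (s x)) -
      mvfderiv 𝓘(ℝ, E) (pairing s (Q.ρ ξ)) x (𝓑.anchor x (t x)) -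
        pairing (𝓑.bracket s t) (Q.ρ ξ) x at h
    rw [Q.eval₂_dualDifferential_ρ hB_symm hB_inv, pairing_ρ_apply] at h
    simp only [hξ, hfun]
    linarith

end QuasiPoissonBialgebroid

end

end QuasiPoisson

end

theorem proposition1p23
    {E : Type*} [NormedAddCommGroup E] [NormedSpace ℝ E] [FiniteDimensional ℝ E]
    {M : Type*} [TopologicalSpace M] [T2Space M] [SigmaCompactSpace M] [ChartedSpace E M]
    [IsManifold 𝓘(ℝ, E) ∞ M]
    {F : Type*} [NormedAddCommGroup F] [NormedSpace ℝ F] [FiniteDimensional ℝ F]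
    {A : M → Type*} [TopologicalSpace (Bundle.TotalSpace F A)] [∀ x, TopologicalSpace (A x)]
    [FiberBundle F A] [∀ x, AddCommGroup (A x)] [∀ x, Module ℝ (A x)] [VectorBundle ℝ F A]
    [ContMDiffVectorBundle ∞ F A 𝓘(ℝ, E)]
    {𝔤 : Type*} [LieRing 𝔤] [LieAlgebra ℝ 𝔤] [FiniteDimensional ℝ 𝔤]
    (B : LinearMap.BilinForm ℝ 𝔤) (hB_symm : B.IsSymm) (hB : B.Nondegenerate)
    (hB_inv : ∀ ξ η ζ : 𝔤, B ⁅ξ, η⁆ ζ = B ξ ⁅η, ζ⁆)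
    (act : QuasiPoisson.InfinitesimalAction E M 𝔤)
    (Q : QuasiPoisson.QuasiPoissonBialgebroid F A B hB act) :
    ∃ 𝓑 : QuasiPoisson.LieAlgebroid E (F →L[ℝ] ℝ) (QuasiPoisson.DualBundle A),
      (∀ (n : ℕ) (e : Module.Basis (Fin n) ℝ 𝔤),
        QuasiPoisson.IsDifferentialOfDual 𝓑 (Q.dualDifferential e)) ∧
      (∃ 𝓛 : 𝔤 →ₗ[ℝ] Module.End ℝ
          Cₛ^∞⟮𝓘(ℝ, E); F →L[ℝ] ℝ, QuasiPoisson.DualBundle A⟯,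
        Q.IsDualAction 𝓛 ∧ QuasiPoisson.ActionPreserves 𝓑 act 𝓛) ∧
      QuasiPoisson.IsMorphismToLieAlgebra 𝓑 Q.μ := by
  let e := Module.finBasis ℝ 𝔤
  have hd := Q.isDegreeOneDerivation_dualDifferential e
  have hsq := Q.dualDifferential_sq hB_symm hB_inv
  obtain ⟨𝓑, hb, ha⟩ := QuasiPoisson.exists_dual_lieAlgebroid hd hsq
  have h𝓑 := QuasiPoisson.isDifferentialOfDual hsq hb ha
  refine ⟨𝓑, fun n f => ?_, ⟨Q.dualAction, Q.isDualAction_dualAction,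
    Q.actionPreserves_dualAction hB_symm hB_inv e hb ha⟩,
    Q.isMorphismToLieAlgebra_μ hB_symm hB_inv e h𝓑⟩
  -- The structure was built from one basis, but the differential does not depend on that choice.
  rw [Q.dualDifferential_eq_dualDifferential hB_symm f e]
  exact h𝓑
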